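/- Let $p$ be a prime number, let $t>0$ and let $\lambda=(t,t,0,\dots,0)\in\mathbb R^p$. Let $\mathcal O_\lambda$ be the set of Hermitian $p\times p$ matrices with spectrum $\lambda$, that is, the orbit of $\mathrm{diag}(\lambda)$ under conjugation by $U(p)$, so that $\mathcal O_\lambda\cong\mathrm{Gr}(2,p)$. Equip it with the Kirillov–Kostant–Souriau form $\omega_h([X,h],[Y,h])=\mathrm{tr}(i\,h[X,Y])$, where $X,Y$ are skew-Hermitian. Let $\Phi_\lambda=(\Phi_\lambda^{i,j})_{i,j\ge1,\ i+j\le p+1}$ be the Gelfand–Cetlin system, where $\Phi_\lambda^{i,j}(x)$ is the $i$-th largest eigenvalue of the leading principal $(i+j-1)\times(i+j-1)$ submatrix of $x$, and let $\Delta_\lambda$ be the Gelfand–Cetlin polytope of all $(u_{i,j})$ with $u_{i,j+1}\ge u_{i,j}\ge u_{i+1,j}$ and $u_{i,p+1-i}=\lambda_i$. A subset $Y\subset\mathcal O_\lambda$ is displaceable if $\phi(Y)\cap\overline{Y}=\emptyset$ for some Hamiltonian diffeomorphism $\phi$ of $(\mathcal O_\lambda,\omega_\lambda)$. A face $f$ of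 $\Delta_\lambda$, with relative interior $\mathring f$, is Lagrangian if $\Phi_\lambda^{-1}(u)$ is a Lagrangian submanifold for some $u\in\mathring f$, and proper if $f\ne\Delta_\lambda$. A permutation $w$ of $\{1,\dots,p\}$ acts on $\mathcal O_\lambda$ by conjugation with its permutation matrix: $(w\cdot x)_{ij}=x_{w(i)w(j)}$. 1. Every Lagrangian fiber $\Phi_\lambda^{-1}(u)$, $u\in\Delta_\lambda$, which is not homeomorphic to a torus is displaceable. 2. For every proper Lagrangian face $f$ of $\Delta_\lambda$, the fiber $\Phi_\lambda^{-1}(u)$ is displaceable for every $u\in\mathring f$. Moreover there is a permutation $w$ whose action on $\mathcal O_\lambda$ is a Hamiltonian diffeomorphism and satisfies $w\cdot\Phi_\lambda^{-1}(\mathring f)\cap\Phi_\lambda^{-1}(\mathring f)=\emptyset$. 3. Let $r\ge1$ and let $2\le i_1<\dots<i_r\le p-2$ with $i_{s+1}-i_s\ge2$ for all $s$, and let $\gamma_{i_1,\dots,i_r}$ be the face of $\Delta_\lambda$ given by $u_{1,i_s}=u_{1,i_s-1}=u_{2,i_s}=u_{2,i_s-1}$ for $s=1,\dots,r$. Then there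 is a permutation $w$ whose action on $\mathcal O_\lambda$ is a Hamiltonian diffeomorphism and satisfies $w\cdot\Phi_\lambda^{-1}(\mathring\gamma_{i_1,\dots,i_r})\cap\Phi_\lambda^{-1}(\mathring\gamma_{i_1,\dots,i_r})=\emptyset$. -/

import Mathlib

open scoped ContDiff Matrix.Norms.Operator

namespace GelfandCetlin

/-- Complex `n × n` matrices. They carry the operator norm for the sup norm on `ℂⁿ`; only the
topology and the smooth structure of this finite-dimensional real vector space are used. -/
abbrev Mat (n : ℕ) : Type := Matrix (Fin n) (Fin n) ℂ

/-! ### Coadjoint orbits of the unitary group -/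

/-- The orbit `𝒪_λ` of `diag(λ₁, …, λₙ)` under conjugation by unitary matrices. -/
def orbit {n : ℕ} (lam : Fin n → ℝ) : Set (Mat n) :=
  {x | ∃ U ∈ Matrix.unitaryGroup (Fin n) ℂ,
    x = U * Matrix.diagonal (fun i => (lam i : ℂ)) * star U}

theorem orbit_isHermitian {n : ℕ} {lam : Fin n → ℝ} (x : orbit lam) :
    (x : Mat n).IsHermitian := by
  obtain ⟨x, U, hU, rfl⟩ := x
  have h : (Matrix.diagonal (fun i => (lam i : ℂ))).IsHermitian := by
    rw [Matrix.isHermitian_diagonal_iff]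
    intro i
    simp [isSelfAdjoint_iff]
  exact Matrix.isHermitian_mul_mul_conjTranspose U h

/-- The action of the unitary group on `𝒪_λ` by conjugation. -/
def unitaryAct {n : ℕ} {lam : Fin n → ℝ} (U : Matrix.unitaryGroup (Fin n) ℂ)
    (x : orbit lam) : orbit lam :=
  ⟨(U : Mat n) * x * star (U : Mat n), by
    obtain ⟨x, V, hV, rfl⟩ := x
    exact ⟨U * V, mul_mem U.2 hV, by simp only [star_mul, mul_assoc]⟩⟩

theorem permMatrix_mem_unitaryGroup {n : ℕ} (w : Equiv.Perm (Fin n)) :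
    w.permMatrix ℂ ∈ Matrix.unitaryGroup (Fin n) ℂ := by
  rw [Matrix.mem_unitaryGroup_iff, Matrix.star_eq_conjTranspose,
    Matrix.conjTranspose_permMatrix, ← Matrix.permMatrix_mul]
  simp

/-- The action of a permutation on `𝒪_λ` through its permutation matrix: the `(i, j)` entry of
`w · x` is `x (w i) (w j)`. -/
def permAct {n : ℕ} {lam : Fin n → ℝ} (w : Equiv.Perm (Fin n)) (x : orbit lam) : orbit lam :=
  unitaryAct ⟨w.permMatrix ℂ, permMatrix_mem_unitaryGroup w⟩ x

/-! ### The Kirillov–Kostant–Souriau form and Hamiltonian diffeomorphisms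

The tangent space of the orbit at `h` consists of the brackets `⁅X, h⁆`, with `X` skew-Hermitian,
and the symplectic form is `ω_h(⁅X, h⁆, ⁅Y, h⁆) = tr(i h ⁅X, Y⁆)`. -/

/-- The value `ω_h(⁅X, h⁆, ⁅Y, h⁆) = tr(i h ⁅X, Y⁆)` (a real number when `h` is Hermitian and
`X`, `Y` are skew-Hermitian) of the Kirillov–Kostant–Souriau form. -/
noncomputable def kks {n : ℕ} (h X Y : Mat n) : ℝ :=
  (Matrix.trace (Complex.I • (h * ⁅X, Y⁆))).re

/-- `kks` depends only on the tangent vectors `⁅X, h⁆` and `⁅Y, h⁆`. -/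
theorem kks_congr {n : ℕ} {h X X' Y Y' : Mat n} (hX : ⁅X, h⁆ = ⁅X', h⁆)
    (hY : ⁅Y, h⁆ = ⁅Y', h⁆) : kks h X Y = kks h X' Y' := by
  have e₁ : ∀ A B : Mat n, Matrix.trace (h * ⁅A, B⁆) = -Matrix.trace (B * ⁅A, h⁆) := by
    intro A B
    simp only [Ring.lie_def, mul_sub, Matrix.trace_sub, ← mul_assoc]
    rw [Matrix.trace_mul_cycle h A B, Matrix.trace_mul_cycle h B A,
      Matrix.trace_mul_cycle A h B]
    ring
  have e₂ : ∀ A B : Mat n, Matrix.trace (h * ⁅A, B⁆) = Matrix.trace (A * ⁅B, h⁆) := by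
    intro A B
    have hs : ⁅A, B⁆ = -⁅B, A⁆ := by simp only [Ring.lie_def, neg_sub]
    rw [hs, mul_neg, Matrix.trace_neg, e₁ B A, neg_neg]
  simp only [kks, Matrix.trace_smul]
  rw [e₁ X Y, hX, ← e₁ X' Y, e₂ X' Y, hY, ← e₂ X' Y']

/-- `φ` is a Hamiltonian diffeomorphism of `(𝒪_λ, ω_λ)`: the time-one map of the flow of a smooth
time-dependent Hamiltonian `H`. As `𝒪_λ` is a compact submanifold of the space of matrices, smooth
functions on `𝒪_λ` are the restrictions of smooth functions of the matrix. The velocity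
`⁅X, F s x⁆` of the flow line through `x` satisfies `ω(⁅X, F s x⁆, ·) = d H_s` on the tangent
space of the orbit. -/
def IsHamiltonianDiffeo {n : ℕ} {lam : Fin n → ℝ} (φ : orbit lam → orbit lam) : Prop :=
  ∃ (H : ℝ → Mat n → ℝ) (F : ℝ → orbit lam → orbit lam),
    ContDiff ℝ ∞ (fun q : ℝ × Mat n => H q.1 q.2) ∧
    (∀ x, F 0 x = x) ∧ (∀ x, F 1 x = φ x) ∧
    ∀ s ∈ Set.Icc (0 : ℝ) 1, ∀ x : orbit lam, ∃ X : Mat n, star X = -X ∧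
      HasDerivWithinAt (fun r => (F r x : Mat n)) ⁅X, (F s x : Mat n)⁆ (Set.Icc 0 1) s ∧
      ∀ Y : Mat n, star Y = -Y →
        kks (F s x) X Y = fderiv ℝ (H s) (F s x) ⁅Y, (F s x : Mat n)⁆

/-- `Y` is displaceable: some Hamiltonian diffeomorphism `φ` satisfies `φ(Y) ∩ closure Y = ∅`. -/
def IsDisplaceable {n : ℕ} {lam : Fin n → ℝ} (Y : Set (orbit lam)) : Prop :=
  ∃ φ : orbit lam → orbit lam, IsHamiltonianDiffeo φ ∧ Disjoint (φ '' Y) (closure Y)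

/-! ### Lagrangian submanifolds and tori -/

/-- `S` is a smooth embedded submanifold of `E` (without boundary): around each of its points there
is a smooth chart of `E` in which `S` becomes a linear subspace `W`. -/
def IsEmbeddedSubmanifold {E : Type*} [NormedAddCommGroup E] [NormedSpace ℝ E]
    (S : Set E) : Prop :=
  ∀ x ∈ S, ∃ (e : OpenPartialHomeomorph E E) (W : Submodule ℝ E),
    x ∈ e.source ∧ ContDiffOn ℝ ∞ e e.source ∧ ContDiffOn ℝ ∞ e.symm e.target ∧
    e '' (S ∩ e.source) = (W : Set E) ∩ e.target

/-- The tangent vectors of `S` at `x`: the velocities at `x` of the smooth curves in `S`. -/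
def tangentVectors {E : Type*} [NormedAddCommGroup E] [NormedSpace ℝ E]
    (S : Set E) (x : E) : Set E :=
  {v | ∃ c : ℝ → E, ContDiff ℝ ∞ c ∧ (∀ s, c s ∈ S) ∧ c 0 = x ∧ HasDerivAt c v 0}

/-- `Y` is a Lagrangian submanifold of `(𝒪_λ, ω_λ)`: an embedded submanifold whose tangent space
at each point is equal to its own orthogonal for the symplectic form in the tangent space of
`𝒪_λ` (equivalently, `ω_λ` vanishes on `Y` and `Y` has half the dimension of `𝒪_λ`). -/
def IsLagrangian {n : ℕ} {lam : Fin n → ℝ} (Y : Set (orbit lam)) : Prop :=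
  IsEmbeddedSubmanifold (Subtype.val '' Y : Set (Mat n)) ∧
  ∀ x ∈ Y, ∀ A : Mat n, star A = -A →
    (⁅A, (x : Mat n)⁆ ∈ tangentVectors (Subtype.val '' Y : Set (Mat n)) (x : Mat n) ↔
      ∀ B : Mat n, star B = -B →
        ⁅B, (x : Mat n)⁆ ∈ tangentVectors (Subtype.val '' Y : Set (Mat n)) (x : Mat n) →
        kks x A B = 0)

/-- The space `Y` is a torus `(S¹)ᵈ` for some `d ≥ 0`. -/
def IsTorus {α : Type*} [TopologicalSpace α] (Y : Set α) : Prop :=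
  ∃ d : ℕ, Nonempty (Y ≃ₜ (Fin d → Circle))

/-! ### The Gelfand–Cetlin system and its polytope -/

/-- The pairs `(i, j)` of positive integers with `i + j ≤ n + 1`. -/
abbrev Index (n : ℕ) : Type := {q : ℕ × ℕ // 1 ≤ q.1 ∧ 1 ≤ q.2 ∧ q.1 + q.2 ≤ n + 1}

/-- The Gelfand–Cetlin system: its `(i, j)` component at `x` is the `i`-th largest eigenvalue of
the leading principal `(i + j - 1) × (i + j - 1)` submatrix of `x`. (`eigenvalues₀` lists the
eigenvalues with multiplicities in non-increasing order, starting from the index `0`.) -/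
noncomputable def gcMap {n : ℕ} {lam : Fin n → ℝ} (x : orbit lam) : Index n → ℝ := fun q =>
  have hm : q.1.1 + q.1.2 - 1 ≤ n := by have := q.2; omega
  ((orbit_isHermitian x).submatrix (Fin.castLE hm)).eigenvalues₀
    ⟨q.1.1 - 1, by have := q.2; rw [Fintype.card_fin]; omega⟩

/-- The Gelfand–Cetlin polytope: the arrays with `u_{i,j+1} ≥ u_{i,j} ≥ u_{i+1,j}` and
`u_{i,n+1-i} = λ_i`. -/
def gcPolytope {n : ℕ} (lam : Fin n → ℝ) : Set (Index n → ℝ) :=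
  {u | (∀ (q : Index n) (i : Fin n), q.1.1 + q.1.2 = n + 1 → q.1.1 = (i : ℕ) + 1 → u q = lam i) ∧
    (∀ q q' : Index n, q'.1.1 = q.1.1 → q'.1.2 = q.1.2 + 1 → u q ≤ u q') ∧
    (∀ q q' : Index n, q'.1.1 = q.1.1 + 1 → q'.1.2 = q.1.2 → u q' ≤ u q)}

/-- The fiber of the Gelfand–Cetlin system over `u`. -/
def gcFiber {n : ℕ} (lam : Fin n → ℝ) (u : Index n → ℝ) : Set (orbit lam) :=
  {x | gcMap x = u}

/-- `f` is a (nonempty) face of the Gelfand–Cetlin polytope other than the polytope itself. -/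
def IsProperFace {n : ℕ} (lam : Fin n → ℝ) (f : Set (Index n → ℝ)) : Prop :=
  f.Nonempty ∧ IsExposed ℝ (gcPolytope lam) f ∧ f ≠ gcPolytope lam

/-- A face is Lagrangian if the fiber over some point of its relative interior is Lagrangian. -/
def IsLagrangianFace {n : ℕ} (lam : Fin n → ℝ) (f : Set (Index n → ℝ)) : Prop :=
  ∃ u ∈ intrinsicInterior ℝ f, IsLagrangian (gcFiber lam u)

/-- A face is displaceable if every fiber over its relative interior is displaceable. -/
def IsDisplaceableFace {n : ℕ} (lam : Fin n → ℝ) (f : Set (Index n → ℝ)) : Prop :=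
  ∀ u ∈ intrinsicInterior ℝ f, IsDisplaceable (gcFiber lam u)

/-- The permutation matrix of `w` acts on `𝒪_λ` as a Hamiltonian diffeomorphism which moves the
preimage of the relative interior of the face `f` off itself. -/
def PermDisplacesFace {n : ℕ} (lam : Fin n → ℝ) (f : Set (Index n → ℝ))
    (w : Equiv.Perm (Fin n)) : Prop :=
  IsHamiltonianDiffeo (permAct (lam := lam) w) ∧
  Disjoint (permAct (lam := lam) w '' (gcMap ⁻¹' intrinsicInterior ℝ f))
    (gcMap ⁻¹' intrinsicInterior ℝ f)

/-- The pattern `λ = (t, …, t, 0, …, 0)` with `k` entries `t` and `n - k` entries `0`, for which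
`𝒪_λ` is the Grassmannian `Gr(k, n)`. -/
def grassmannPattern (k n : ℕ) (t : ℝ) : Fin n → ℝ := fun i => if (i : ℕ) < k then t else 0

/-- The face `γ_{i₁, …, i_r}` for `I = {i₁, …, i_r}`: for each `i ∈ I`, the `k²` coordinates
`u_{a,b}` with `1 ≤ a ≤ k` and `i - k + 1 ≤ b ≤ i` are equal to one another. -/
def squareFace (k n : ℕ) (t : ℝ) (I : Finset ℕ) : Set (Index n → ℝ) :=
  {u | u ∈ gcPolytope (grassmannPattern k n t) ∧
    ∀ i ∈ I, ∀ q q' : Index n,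
      (q.1.1 ≤ k ∧ i + 1 ≤ q.1.2 + k ∧ q.1.2 ≤ i) →
      (q'.1.1 ≤ k ∧ i + 1 ≤ q'.1.2 + k ∧ q'.1.2 ≤ i) → u q = u q'}

/-- `I = {i₁ < ⋯ < i_r}` with `r ≥ 1`, `k ≤ i₁`, `i_r ≤ n - k` and `i_{s+1} - i_s ≥ k`. -/
def IsSquareSequence (k n : ℕ) (I : Finset ℕ) : Prop :=
  I.Nonempty ∧ (∀ i ∈ I, k ≤ i ∧ i + k ≤ n) ∧ ∀ i ∈ I, ∀ j ∈ I, i < j → i + k ≤ j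

end GelfandCetlin

open GelfandCetlin

/-!
Permutations act on the orbit by unitary matrices, hence by Hamiltonian flows, so it is enough to
find a permutation which moves the fibers off themselves. Write a point of the orbit as
`x = A * Aᴴ`, where the `n × 2` matrix `A` has orthogonal columns of squared norm `t`. The Bloch
vectors of the rows of `A` are the edges of a closed polygon in `ℝ³`. The `j`-th partial perimeter
and the length of the `j`-th diagonal of this polygon are the sum and the difference of the two
largest eigenvalues of the leading `j × j` submatrix of `x`. Hence equalities between
neighbouring Gelfand–Cetlin coordinates say that triangles cut out by the diagonals are degenerate,
and permuting the rows reorders the edges. When the number of edges is prime, some reordering of a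
polygon with a degenerate triangle does not have the same degenerate triangles. If no triangle is
degenerate, then rebuilding `A` row by row shows that the fiber is a torus of phases.
-/

namespace GelfandCetlin

/-! ### Unitary matrices act by Hamiltonian diffeomorphisms -/

theorem exists_mem_skewAdjoint_exp_eq {A : Type*} [CStarAlgebra A] {U : A} (hU : U ∈ unitary A)
    (hfin : (spectrum ℂ U).Finite) : ∃ X ∈ skewAdjoint A, NormedSpace.exp X = U := by
  have hnormal : IsStarNormal U := ⟨by
    rw [commute_iff_eq, Unitary.star_mul_self_of_mem hU, Unitary.mul_star_self_of_mem hU]⟩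
  refine ⟨cfc (fun z => (Complex.log z - star (Complex.log z)) / 2) U, ?_, ?_⟩
  · rw [skewAdjoint.mem_iff, ← cfc_star, ← cfc_neg]
    refine cfc_congr fun z _ => ?_
    simp only [star_div₀, star_sub, star_star, star_ofNat]
    ring
  · rw [← CFC.complex_exp_eq_normedSpace_exp (cfc_predicate _ _),
      ← cfc_comp' Complex.exp _ U (by fun_prop) (hfin.continuousOn _)]
    conv_rhs => rw [← cfc_id ℂ U]
    refine cfc_congr fun z hz => ?_
    have hnorm : ‖z‖ = 1 := by simpa using spectrum.subset_circle_of_unitary hU hz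
    have hz0 : z ≠ 0 := norm_ne_zero_iff.mp (hnorm ▸ one_ne_zero)
    have hlog : (Complex.log z - star (Complex.log z)) / 2 = Complex.log z := by
      apply Complex.ext <;> simp [Complex.log_re, hnorm, Complex.log_im]
    simp only [hlog, Complex.exp_log hz0, id]

theorem exists_mem_skewAdjoint_exp_eq_of_mem_unitaryGroup {n : ℕ} {U : Mat n}
    (hU : U ∈ Matrix.unitaryGroup (Fin n) ℂ) : ∃ X ∈ skewAdjoint (Mat n), NormedSpace.exp X = U :=
  @exists_mem_skewAdjoint_exp_eq (Mat n) Matrix.instCStarAlgebra U hU (Matrix.finite_spectrum U)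

theorem exp_smul_mem_unitaryGroup {n : ℕ} {X : Mat n} (hX : X ∈ skewAdjoint (Mat n)) (s : ℝ) :
    NormedSpace.exp (s • X) ∈ Matrix.unitaryGroup (Fin n) ℂ := by
  rw [Matrix.mem_unitaryGroup_iff, NormedSpace.star_exp, star_smul, skewAdjoint.mem_iff.mp hX,
    star_trivial, smul_neg,
    ← Matrix.exp_add_of_commute _ _ (Commute.refl (s • X)).neg_right, add_neg_cancel,
    NormedSpace.exp_zero]

theorem hasDerivAt_exp_smul_conj {A : Type*} [NormedRing A] [NormedAlgebra ℝ A] [CompleteSpace A]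
    (X z : A) (s : ℝ) :
    HasDerivAt (fun r : ℝ => NormedSpace.exp (r • X) * z * NormedSpace.exp (r • -X))
      ⁅X, NormedSpace.exp (s • X) * z * NormedSpace.exp (s • -X)⁆ s := by
  convert! ((hasDerivAt_exp_smul_const' (𝕂 := ℝ) X s).mul_const z).mul
    (hasDerivAt_exp_smul_const (𝕂 := ℝ) (-X) s) using 1
  rw [Ring.lie_def]
  noncomm_ring

theorem trace_mul_lie {ι R : Type*} [Fintype ι] [CommRing R] (A B C : Matrix ι ι R) :
    Matrix.trace (A * ⁅B, C⁆) = Matrix.trace (B * ⁅C, A⁆) := by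
  simp only [Ring.lie_def, mul_sub, Matrix.trace_sub, ← mul_assoc]
  rw [Matrix.trace_mul_cycle B C A, Matrix.trace_mul_cycle A C B]

/-- The Hamiltonian `z ↦ Re tr(i X z)`, whose flow is conjugation by `exp(s X)`. -/
noncomputable def linearHamiltonian {n : ℕ} (X : Mat n) : Mat n →L[ℝ] ℝ :=
  LinearMap.toContinuousLinearMap
    { toFun := fun z => (Matrix.trace (Complex.I • (X * z))).re
      map_add' := fun a b => by simp [mul_add]
      map_smul' := fun c a => by simp [Matrix.trace_smul] }

theorem kks_eq_linearHamiltonian {n : ℕ} (h X Y : Mat n) :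
    kks h X Y = linearHamiltonian X ⁅Y, h⁆ := by
  change _ = (Matrix.trace (Complex.I • (X * ⁅Y, h⁆))).re
  rw [kks, Matrix.trace_smul, Matrix.trace_smul, trace_mul_lie]

theorem isHamiltonianDiffeo_unitaryAct {n : ℕ} {lam : Fin n → ℝ}
    (U : Matrix.unitaryGroup (Fin n) ℂ) : IsHamiltonianDiffeo (unitaryAct (lam := lam) U) := by
  obtain ⟨X, hX, hU⟩ := exists_mem_skewAdjoint_exp_eq_of_mem_unitaryGroup U.2
  have hstar (s : ℝ) : star (NormedSpace.exp (s • X)) = NormedSpace.exp (s • -X) := by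
    rw [NormedSpace.star_exp, star_smul, skewAdjoint.mem_iff.mp hX, star_trivial]
  refine ⟨fun _ => linearHamiltonian X,
    fun s x => unitaryAct ⟨_, exp_smul_mem_unitaryGroup hX s⟩ x,
    (linearHamiltonian X).contDiff.comp contDiff_snd, fun x => Subtype.ext ?_,
    fun x => Subtype.ext ?_, fun s _ x => ⟨X, skewAdjoint.mem_iff.mp hX, ?_, fun Y _ => ?_⟩⟩
  · simp [unitaryAct]
  · simp [unitaryAct, hU]
  · simp only [unitaryAct, hstar]
    exact (hasDerivAt_exp_smul_conj X x s).hasDerivWithinAt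
  · rw [ContinuousLinearMap.fderiv, kks_eq_linearHamiltonian]

theorem isHamiltonianDiffeo_permAct {n : ℕ} {lam : Fin n → ℝ} (w : Equiv.Perm (Fin n)) :
    IsHamiltonianDiffeo (permAct (lam := lam) w) :=
  isHamiltonianDiffeo_unitaryAct _

/-! ### Closed polygons and their degenerate triangles -/

section Vertex

variable {M : Type*}

/-- The vertices of the polygon which starts at the origin and has edges `e 0, e 1, …`. -/
def vertex [AddCommMonoid M] (e : ℕ → M) (j : ℕ) : M := ∑ i ∈ Finset.range j, e i

theorem vertex_zero [AddCommMonoid M] (e : ℕ → M) : vertex e 0 = 0 := Finset.sum_range_zero e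

theorem vertex_one [AddCommMonoid M] (e : ℕ → M) : vertex e 1 = e 0 := Finset.sum_range_one e

theorem vertex_succ [AddCommMonoid M] (e : ℕ → M) (j : ℕ) :
    vertex e (j + 1) = vertex e j + e j :=
  Finset.sum_range_succ e j

theorem vertex_congr [AddCommMonoid M] {e e' : ℕ → M} {j : ℕ} (h : ∀ i < j, e i = e' i) :
    vertex e j = vertex e' j :=
  Finset.sum_congr rfl fun i hi => h i (Finset.mem_range.mp hi)

/-- The `p`-periodic extension of a sequence indexed by `Fin p`, used to run through the edges of a
closed polygon cyclically. -/
def periodize {p : ℕ} [NeZero p] (e : Fin p → M) (n : ℕ) : M := e (Fin.ofNat p n)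

variable {p : ℕ} [NeZero p]

theorem periodize_val (e : Fin p → M) (i : Fin p) : periodize e i = e i := by
  rw [periodize, Fin.ofNat_val_eq_self]

theorem periodize_comp_swap_left (e : Fin p → M) (a b : ℕ) :
    periodize (e ∘ Equiv.swap (Fin.ofNat p a) (Fin.ofNat p b)) a = periodize e b := by
  simp only [periodize, Function.comp_apply, Equiv.swap_apply_left]

theorem periodize_comp_swap_right (e : Fin p → M) (a b : ℕ) :
    periodize (e ∘ Equiv.swap (Fin.ofNat p a) (Fin.ofNat p b)) b = periodize e a := by
  simp only [periodize, Function.comp_apply, Equiv.swap_apply_right]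

theorem periodize_comp_swap_of_lt (e : Fin p → M) {a b n : ℕ} (hna : n < a) (hab : a < b)
    (hb : b < p) :
    periodize (e ∘ Equiv.swap (Fin.ofNat p a) (Fin.ofNat p b)) n = periodize e n := by
  have hne : ∀ {x : ℕ}, n < x → x < p → Fin.ofNat p n ≠ Fin.ofNat p x := fun hx hxp => by
    simp only [ne_eq, Fin.ext_iff, Fin.val_ofNat, Nat.mod_eq_of_lt hxp,
      Nat.mod_eq_of_lt (hx.trans hxp)]
    exact hx.ne
  rw [periodize, Function.comp_apply,
    Equiv.swap_apply_of_ne_of_ne (hne hna (hab.trans hb)) (hne (hna.trans hab) hb), periodize]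

theorem vertex_periodize_comp_swap [AddCommMonoid M] (e : Fin p → M) {a b n : ℕ} (hna : n ≤ a)
    (hab : a < b) (hb : b < p) :
    vertex (periodize (e ∘ Equiv.swap (Fin.ofNat p a) (Fin.ofNat p b))) n =
      vertex (periodize e) n :=
  vertex_congr fun _ hi => periodize_comp_swap_of_lt e (hi.trans_le hna) hab hb

theorem vertex_periodize_comp_swap_succ [AddCommMonoid M] (e : Fin p → M) {j : ℕ}
    (hj : j + 1 < p) :
    vertex (periodize (e ∘ Equiv.swap (Fin.ofNat p j) (Fin.ofNat p (j + 1)))) (j + 1 + 1) =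
      vertex (periodize e) (j + 1 + 1) := by
  simp only [vertex_succ, vertex_periodize_comp_swap e le_rfl j.lt_succ_self hj,
    periodize_comp_swap_left, periodize_comp_swap_right]
  exact add_right_comm _ _ _

theorem periodize_comp_addRight (e : Fin p → M) (c n : ℕ) :
    periodize (e ∘ Equiv.addRight (Fin.ofNat p c)) n = periodize e (n + c) := by
  simp only [periodize, Function.comp_apply, Equiv.coe_addRight]
  congr 1
  ext
  simp [Fin.val_add, Nat.add_mod]

theorem vertex_periodize_self [AddCommMonoid M] (e : Fin p → M) :
    vertex (periodize e) p = ∑ i, e i := by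
  rw [vertex, ← Fin.sum_univ_eq_sum_range]
  exact Finset.sum_congr rfl fun i _ => periodize_val e i

theorem vertex_periodize_comp_addRight [AddCommGroup M] (e : Fin p → M) (c n : ℕ) :
    vertex (periodize (e ∘ Equiv.addRight (Fin.ofNat p c))) n =
      vertex (periodize e) (n + c) - vertex (periodize e) c := by
  induction n with
  | zero => rw [vertex_zero, zero_add, sub_self]
  | succ n ih =>
    rw [vertex_succ, ih, periodize_comp_addRight, add_right_comm, vertex_succ, add_sub_right_comm]

theorem vertex_periodize_mod [AddCommGroup M] {e : Fin p → M} (h : ∑ i, e i = 0) (n : ℕ) :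
    vertex (periodize e) (n % p) = vertex (periodize e) n := by
  refine Function.Periodic.map_mod_nat (f := vertex (periodize e)) (fun m => ?_) n
  have hrot : e ∘ Equiv.addRight (Fin.ofNat p p) = e := by ext i; simp
  have hadd := vertex_periodize_comp_addRight e p m
  rw [hrot, vertex_periodize_self, h, sub_zero] at hadd
  exact hadd.symm

end Vertex

section Shape

variable {V : Type*} [NormedAddCommGroup V]

/-- The edge `e j` points straight back towards the origin, without passing it. -/
def Shrinks (e : ℕ → V) (j : ℕ) : Prop := ‖vertex e j‖ = ‖vertex e (j + 1)‖ + ‖e j‖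

/-- The edge `e j` points straight away from the origin. -/
def Grows (e : ℕ → V) (j : ℕ) : Prop := ‖vertex e (j + 1)‖ = ‖vertex e j‖ + ‖e j‖

/-- The edge `e j` passes through the origin. -/
def Folds (e : ℕ → V) (j : ℕ) : Prop := ‖e j‖ = ‖vertex e j‖ + ‖vertex e (j + 1)‖

/-- The triangle spanned by the origin and the edge `e j` is degenerate. -/
def IsFlat (e : ℕ → V) (j : ℕ) : Prop := Shrinks e j ∨ Grows e j ∨ Folds e j

/-- The first `p` triangles of the two polygons are degenerate in the same way. -/
def SameShape (p : ℕ) (e e' : ℕ → V) : Prop :=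
  ∀ j < p, (Shrinks e j ↔ Shrinks e' j) ∧ (Grows e j ↔ Grows e' j) ∧ (Folds e j ↔ Folds e' j)

theorem shrinks_and_grows_iff {e : ℕ → V} {j : ℕ} : Shrinks e j ∧ Grows e j ↔ e j = 0 := by
  constructor
  · rintro ⟨hs, hg⟩
    rw [Shrinks] at hs
    rw [Grows] at hg
    exact norm_eq_zero.mp (by linarith)
  · intro h
    simp [Shrinks, Grows, vertex_succ, h]

theorem grows_and_folds_iff {e : ℕ → V} {j : ℕ} : Grows e j ∧ Folds e j ↔ vertex e j = 0 := by
  constructor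
  · rintro ⟨hg, hf⟩
    rw [Grows] at hg
    rw [Folds] at hf
    exact norm_eq_zero.mp (by linarith)
  · intro h
    simp [Grows, Folds, vertex_succ, h]

namespace SameShape

variable {p j : ℕ} {e e' : ℕ → V}

theorem edge_eq_zero_iff (h : SameShape p e e') (hj : j < p) : e j = 0 ↔ e' j = 0 := by
  rw [← shrinks_and_grows_iff, ← shrinks_and_grows_iff, (h j hj).1, (h j hj).2.1]

theorem vertex_eq_zero_iff (h : SameShape p e e') (hj : j < p) :
    vertex e j = 0 ↔ vertex e' j = 0 := by
  rw [← grows_and_folds_iff, ← grows_and_folds_iff, (h j hj).2.1, (h j hj).2.2]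

theorem isFlat_iff (h : SameShape p e e') (hj : j < p) : IsFlat e j ↔ IsFlat e' j := by
  rw [IsFlat, IsFlat, (h j hj).1, (h j hj).2.1, (h j hj).2.2]

end SameShape

theorem not_grows_of_vertex_succ_eq_zero {e : ℕ → V} {j : ℕ} (he : e j ≠ 0)
    (hv : vertex e (j + 1) = 0) : ¬ Grows e j := fun h => by
  rw [Grows, hv, norm_zero] at h
  linarith [norm_pos_iff.mpr he, norm_nonneg (vertex e j)]

section StrictConvex

variable [NormedSpace ℝ V] [StrictConvexSpace ℝ V]

theorem shrinks_iff_sameRay {e : ℕ → V} {j : ℕ} :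
    Shrinks e j ↔ SameRay ℝ (vertex e (j + 1)) (-e j) := by
  rw [sameRay_iff_norm_add, norm_neg, vertex_succ, add_neg_cancel_right, Shrinks, vertex_succ]

theorem grows_iff_sameRay {e : ℕ → V} {j : ℕ} : Grows e j ↔ SameRay ℝ (vertex e j) (e j) := by
  rw [sameRay_iff_norm_add, Grows, vertex_succ]

theorem folds_iff_sameRay {e : ℕ → V} {j : ℕ} :
    Folds e j ↔ SameRay ℝ (vertex e (j + 1)) (-vertex e j) := by
  rw [sameRay_iff_norm_add, norm_neg, vertex_succ, add_neg_cancel_comm, Folds, vertex_succ,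
    add_comm ‖vertex e j‖]

theorem IsFlat.exists_smul {e : ℕ → V} {j : ℕ} (h : IsFlat e j) (hne : vertex e (j + 1) ≠ 0) :
    ∃ r : ℝ, e j = r • vertex e (j + 1) := by
  rcases h with h | h | h
  · obtain ⟨r, -, hr⟩ := (shrinks_iff_sameRay.mp h).exists_nonneg_left hne
    exact ⟨-r, by rw [neg_smul, hr, neg_neg]⟩
  · have hray := (grows_iff_sameRay.mp h).add_left (SameRay.refl (e j))
    rw [← vertex_succ] at hray
    obtain ⟨r, -, hr⟩ := hray.exists_nonneg_left hne
    exact ⟨r, hr.symm⟩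
  · obtain ⟨r, -, hr⟩ := (folds_iff_sameRay.mp h).exists_nonneg_left hne
    exact ⟨1 + r, by rw [add_smul, one_smul, hr, vertex_succ, add_neg_cancel_comm]⟩

theorem vertex_ne_zero_and_sameRay_of_grows {e : ℕ → V} {k : ℕ} (h0 : e 0 ≠ 0)
    (h : ∀ j, 1 ≤ j → j ≤ k → Grows e j) :
    vertex e (k + 1) ≠ 0 ∧ SameRay ℝ (vertex e (k + 1)) (e 0) := by
  induction k with
  | zero => rw [zero_add, vertex_one]; exact ⟨h0, SameRay.refl _⟩
  | succ k ih =>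
    obtain ⟨hne, hray⟩ := ih fun j hj hjk => h j hj (hjk.trans k.le_succ)
    have hgrow := h (k + 1) k.succ_pos le_rfl
    refine ⟨norm_pos_iff.mp ?_, ?_⟩
    · rw [hgrow]
      exact add_pos_of_pos_of_nonneg (norm_pos_iff.mpr hne) (norm_nonneg _)
    · rw [vertex_succ]
      exact hray.add_left ((grows_iff_sameRay.mp hgrow).symm.trans hray fun h => absurd h hne)

end StrictConvex

theorem isFlat_of_eq_smul [NormedSpace ℝ V] {e : ℕ → V} {j : ℕ} {r : ℝ}
    (h : e j = r • vertex e (j + 1)) : IsFlat e j := by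
  have hv : vertex e j = (1 - r) • vertex e (j + 1) := by
    rw [sub_smul, one_smul, ← h, vertex_succ, add_sub_cancel_right]
  rw [IsFlat, Shrinks, Grows, Folds, hv, h, norm_smul, norm_smul, Real.norm_eq_abs,
    Real.norm_eq_abs]
  rcases le_total r 0 with h0 | h0
  · left
    rw [abs_of_nonpos h0, abs_of_nonneg (by linarith)]
    ring
  · rcases le_total r 1 with h1 | h1
    · right; left
      rw [abs_of_nonneg h0, abs_of_nonneg (by linarith)]
      ring
    · right; right
      rw [abs_of_nonneg h0, abs_of_nonpos (by linarith)]
      ring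

end Shape

section BreaksShape

variable {V : Type*} [NormedAddCommGroup V] {p : ℕ} [NeZero p] {e₀ : Fin p → V}

/-- No closed polygon keeps the shape of `e₀` when its edges are permuted by `w`. -/
def BreaksShape (w : Equiv.Perm (Fin p)) (e₀ : Fin p → V) : Prop :=
  ∀ e : Fin p → V, ∑ i, e i = 0 → SameShape p (periodize e) (periodize e₀) →
    ¬ SameShape p (periodize (e ∘ w)) (periodize e₀)

theorem breaksShape_swap_of_edge_eq_zero {i k : Fin p} (hi : e₀ i = 0) (hk : e₀ k ≠ 0) :
    BreaksShape (Equiv.swap i k) e₀ := fun e _ he he' => hk <| by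
  have hswap := he'.edge_eq_zero_iff k.2
  rw [periodize_val, Function.comp_apply, Equiv.swap_apply_right, ← periodize_val e,
    he.edge_eq_zero_iff i.2, periodize_val, periodize_val] at hswap
  exact hswap.mp hi

/-- The vertices at the origin are periodic with period `c`; as `c` is prime to `p`, the first edge
would be zero. -/
theorem breaksShape_addRight {c : ℕ} (hp : 1 < p) (hcp : Nat.Coprime c p) (hsum : ∑ i, e₀ i = 0)
    (h0 : e₀ 0 ≠ 0) (hc : vertex (periodize e₀) c = 0) :
    BreaksShape (Equiv.addRight (Fin.ofNat p c)) e₀ := fun e hes he he' => h0 <| by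
  have hsame : ∀ e' : Fin p → V, ∑ i, e' i = 0 → SameShape p (periodize e') (periodize e₀) →
      ∀ n, vertex (periodize e') n = 0 ↔ vertex (periodize e₀) n = 0 := by
    intro e' hes' he' n
    rw [← vertex_periodize_mod hes', ← vertex_periodize_mod hsum]
    exact he'.vertex_eq_zero_iff (Nat.mod_lt _ (zero_lt_one.trans hp))
  have hshift : ∀ n, vertex (periodize e₀) (n + c) = 0 ↔ vertex (periodize e₀) n = 0 := by
    intro n
    rw [← hsame _ (hes ▸ Equiv.sum_comp (Equiv.addRight (Fin.ofNat p c)) e) he' n,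
      vertex_periodize_comp_addRight, (hsame e hes he c).mpr hc, sub_zero, hsame e hes he]
  have hmul : ∀ m, vertex (periodize e₀) (m * c) = 0 := by
    intro m
    induction m with
    | zero => rw [zero_mul, vertex_zero]
    | succ m ih => rwa [Nat.succ_mul, hshift]
  obtain ⟨m, -, hm⟩ := Nat.exists_mul_mod_eq_one_of_coprime hcp hp
  have hone := hmul m
  rw [← vertex_periodize_mod hsum, mul_comm, hm, vertex_one] at hone
  exact hone

theorem breaksShape_swap_zero_one (hp : 2 < p) (hv : vertex (periodize e₀) 2 ≠ 0)
    (hflat : IsFlat (periodize e₀) 1) (hgrow : ¬ Grows (periodize e₀) 1) :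
    BreaksShape (Equiv.swap (Fin.ofNat p 0) (Fin.ofNat p 1)) e₀ := fun e _ he he' => hv <| by
  rw [← he.vertex_eq_zero_iff hp, ← norm_eq_zero]
  have hp1 : 1 < p := one_lt_two.trans hp
  have hv2 := vertex_periodize_comp_swap_succ e (j := 0) hp1
  have he1 := periodize_comp_swap_right e 0 1
  have hv1 := (vertex_one _).trans (periodize_comp_swap_left e 0 1)
  have hv1' : vertex (periodize e) 1 = periodize e 0 := vertex_one _
  rcases hflat with h | h | h
  · have hs := ((he 1 hp1).1).mpr h
    have hs' := ((he' 1 hp1).1).mpr h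
    rw [Shrinks] at hs hs'
    simp only [zero_add, Nat.reduceAdd] at *
    rw [hv2, hv1, he1, ← hv1'] at hs'
    linarith
  · exact absurd h hgrow
  · have hf := ((he 1 hp1).2.2).mpr h
    have hf' := ((he' 1 hp1).2.2).mpr h
    rw [Folds] at hf hf'
    simp only [zero_add, Nat.reduceAdd] at *
    rw [hv2, hv1, he1, ← hv1'] at hf'
    linarith

variable [NormedSpace ℝ V] [StrictConvexSpace ℝ V]

/-- The edge `1` still grows after the swap, so the edge `k` has the direction of `e 0`, like all
the edges before it. -/
theorem breaksShape_swap_of_grows {k : ℕ} (hk : 1 < k) (hkp : k < p) (h0 : e₀ 0 ≠ 0)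
    (hgrow : ∀ j, 1 ≤ j → j < k → Grows (periodize e₀) j) (hnot : ¬ Grows (periodize e₀) k) :
    BreaksShape (Equiv.swap (Fin.ofNat p 1) (Fin.ofNat p k)) e₀ := fun e _ he he' => hnot <| by
  have h0' : periodize e 0 ≠ 0 := fun h => h0 ((he.edge_eq_zero_iff (j := 0) (by omega)).mp h)
  obtain ⟨k, rfl⟩ : ∃ i, k = i + 1 := ⟨k - 1, by omega⟩
  have hray : SameRay ℝ (vertex (periodize e) (k + 1)) (periodize e 0) :=
    (vertex_ne_zero_and_sameRay_of_grows h0' fun j hj hjk =>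
      (he j (by omega)).2.1.mpr (hgrow j hj (by omega))).2
  have hgrow' := (he' 1 (by omega)).2.1.mpr (hgrow 1 le_rfl hk)
  rw [grows_iff_sameRay, vertex_periodize_comp_swap e le_rfl hk hkp, vertex_one,
    periodize_comp_swap_left] at hgrow'
  exact (he _ hkp).2.1.mp (grows_iff_sameRay.mpr (hray.trans hgrow' fun h => absurd h h0'))

/-- Both edges `j` and `j + 1` of `e` are multiples of the vertex `j + 2`, hence of the vertex
`j + 1`. -/
theorem breaksShape_swap_succ {j : ℕ} (hj : j + 2 < p) (hv1 : vertex (periodize e₀) (j + 1) ≠ 0)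
    (hv2 : vertex (periodize e₀) (j + 2) ≠ 0) (hflat : IsFlat (periodize e₀) (j + 1))
    (hnot : ¬ IsFlat (periodize e₀) j) :
    BreaksShape (Equiv.swap (Fin.ofNat p j) (Fin.ofNat p (j + 1))) e₀ :=
  fun e _ he he' => hnot <| by
  rw [← he.isFlat_iff (by omega)]
  rw [ne_eq, ← he.vertex_eq_zero_iff (by omega)] at hv1 hv2
  have hswap := vertex_periodize_comp_swap_succ e (show j + 1 < p by omega)
  obtain ⟨r, hr⟩ := ((he.isFlat_iff (by omega)).mpr hflat).exists_smul hv2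
  obtain ⟨r', hr'⟩ := ((he'.isFlat_iff (by omega)).mpr hflat).exists_smul (hswap ▸ hv2)
  rw [hswap, periodize_comp_swap_right] at hr'
  have hv : vertex (periodize e) (j + 1) = (1 - r) • vertex (periodize e) (j + 1 + 1) := by
    rw [sub_smul, one_smul, ← hr, vertex_succ _ (j + 1), add_sub_cancel_right]
  have hr1 : 1 - r ≠ 0 := fun h => hv1 (by rw [hv, h, zero_smul])
  refine isFlat_of_eq_smul (r := r' / (1 - r)) ?_
  rw [hv, smul_smul, div_mul_cancel₀ _ hr1, hr']

theorem exists_breaksShape_of_grows_one (hp : 2 < p) (hsum : ∑ i, e₀ i = 0)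
    (hedge : ∀ i, e₀ i ≠ 0) (h1 : Grows (periodize e₀) 1) :
    ∃ w : Equiv.Perm (Fin p), BreaksShape w e₀ := by
  classical
  have hex : ∃ k, 1 ≤ k ∧ k < p ∧ ¬ Grows (periodize e₀) k := by
    refine ⟨p - 1, by omega, by omega, not_grows_of_vertex_succ_eq_zero (hedge _) ?_⟩
    rw [Nat.sub_add_cancel NeZero.one_le, vertex_periodize_self, hsum]
  obtain ⟨hk1, hkp, hk⟩ := Nat.find_spec hex
  refine ⟨_, breaksShape_swap_of_grows (hk1.lt_of_ne fun h => hk (h ▸ h1)) hkp (hedge 0) ?_ hk⟩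
  exact fun j hj hjk => by_contra fun h => Nat.find_min hex hjk ⟨hj, hjk.trans hkp, h⟩

theorem exists_breaksShape_of_isFlat
    (hvertex : ∀ j, 0 < j → j < p → vertex (periodize e₀) j ≠ 0) (h1 : ¬ IsFlat (periodize e₀) 1)
    (hflat : ∃ j, 1 ≤ j ∧ j + 2 ≤ p ∧ IsFlat (periodize e₀) j) :
    ∃ w : Equiv.Perm (Fin p), BreaksShape w e₀ := by
  classical
  obtain ⟨hk1, hkp, hk⟩ := Nat.find_spec hflat
  have hmin := fun m => Nat.find_min hflat (m := m)
  generalize Nat.find hflat = k at *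
  have hk2 : k ≠ 1 := fun h => h1 (h ▸ hk)
  obtain ⟨j, rfl⟩ : ∃ j, k = j + 1 := ⟨k - 1, by omega⟩
  exact ⟨_, breaksShape_swap_succ hkp (hvertex _ (by omega) (by omega))
    (hvertex _ (by omega) (by omega)) hk fun h => hmin j (by omega) ⟨by omega, by omega, h⟩⟩

theorem exists_breaksShape (hp : p.Prime) (hsum : ∑ i, e₀ i = 0) (hne : e₀ ≠ 0)
    (hflat : ∃ j, 1 ≤ j ∧ j + 2 ≤ p ∧ IsFlat (periodize e₀) j) :
    ∃ w : Equiv.Perm (Fin p), BreaksShape w e₀ := by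
  by_cases hedge : ∃ i, e₀ i = 0
  · obtain ⟨i, hi⟩ := hedge
    obtain ⟨k, hk⟩ := Function.ne_iff.mp hne
    exact ⟨_, breaksShape_swap_of_edge_eq_zero hi hk⟩
  push Not at hedge
  by_cases hvertex : ∃ j, 0 < j ∧ j < p ∧ vertex (periodize e₀) j = 0
  · obtain ⟨c, hc, hcp, hc0⟩ := hvertex
    exact ⟨_, breaksShape_addRight hp.one_lt (Nat.coprime_of_lt_prime hc.ne' hcp hp).symm hsum
      (hedge 0) hc0⟩
  push Not at hvertex
  have hp2 : 2 < p := by obtain ⟨j, h1, h2, -⟩ := hflat; omega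
  by_cases h1 : IsFlat (periodize e₀) 1
  · by_cases hgrow : Grows (periodize e₀) 1
    · exact exists_breaksShape_of_grows_one hp2 hsum hedge hgrow
    · exact ⟨_, breaksShape_swap_zero_one hp2 (hvertex 2 two_pos hp2) h1 hgrow⟩
  · exact exists_breaksShape_of_isFlat hvertex h1 hflat

end BreaksShape

/-! ### The Grassmannian as the set of matrices `A * Aᴴ` -/

section Frames

open Matrix

variable {k n : ℕ}

theorem mul_diagonal_grassmannPattern_mul_star (hk : k ≤ n) (t : ℝ) (U : Mat n) :
    U * diagonal (fun i => (grassmannPattern k n t i : ℂ)) * star U =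
      (t : ℂ) • (U.submatrix id (Fin.castLE hk) * (U.submatrix id (Fin.castLE hk))ᴴ) := by
  obtain ⟨m, rfl⟩ := Nat.exists_eq_add_of_le hk
  ext i j
  rw [Matrix.mul_apply, Fin.sum_univ_add, Matrix.smul_apply, Matrix.mul_apply, Finset.smul_sum]
  have hzero : ∀ c : Fin m, (U * diagonal fun i => (grassmannPattern k (k + m) t i : ℂ)) i
      (Fin.natAdd k c) = 0 := fun c => by simp [mul_diagonal, grassmannPattern]
  simp only [hzero, zero_mul, Finset.sum_const_zero, add_zero]
  refine Finset.sum_congr rfl fun c _ => ?_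
  rw [mul_diagonal, grassmannPattern, if_pos (Fin.val_castAdd m c ▸ c.2), mul_comm (U _ _),
    mul_assoc]
  rfl

theorem exists_mem_unitaryGroup_submatrix_eq {𝕜 : Type*} [RCLike 𝕜] (hk : k ≤ n)
    {V : Matrix (Fin n) (Fin k) 𝕜} (hV : Vᴴ * V = 1) :
    ∃ U ∈ Matrix.unitaryGroup (Fin n) 𝕜, U.submatrix id (Fin.castLE hk) = V := by
  let v : Fin n → EuclideanSpace 𝕜 (Fin n) := fun l =>
    WithLp.toLp 2 fun i => if h : (l : ℕ) < k then V i ⟨l, h⟩ else 0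
  have hv : Orthonormal 𝕜 (({l : Fin n | (l : ℕ) < k} : Set (Fin n)).domRestrict v) := by
    rw [orthonormal_iff_ite]
    rintro ⟨a, ha : (a : ℕ) < k⟩ ⟨b, hb : (b : ℕ) < k⟩
    have hab := congrFun₂ hV ⟨a, ha⟩ ⟨b, hb⟩
    rw [mul_apply, one_apply] at hab
    simp only [Fin.mk.injEq, ← Fin.ext_iff] at hab
    simp only [Set.domRestrict_apply, EuclideanSpace.inner_eq_star_dotProduct, Subtype.mk.injEq, v,
      ha, hb, dif_pos, ← hab, dotProduct]
    exact Finset.sum_congr rfl fun i _ => mul_comm _ _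
  obtain ⟨b, hb⟩ := hv.exists_orthonormalBasis_extension_of_card_eq (by simp)
  refine ⟨_, (EuclideanSpace.basisFun (Fin n) 𝕜).toMatrix_orthonormalBasis_mem_unitary b, ?_⟩
  ext i c
  have hbc := hb (Fin.castLE hk c) c.2
  simp [Module.Basis.toMatrix_apply, hbc, v]

theorem mem_orbit_grassmannPattern_iff (hk : k ≤ n) {t : ℝ} (ht : 0 < t) {x : Mat n} :
    x ∈ orbit (grassmannPattern k n t) ↔
      ∃ A : Matrix (Fin n) (Fin k) ℂ, Aᴴ * A = (t : ℂ) • 1 ∧ x = A * Aᴴ := by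
  have hsqrt : √t * √t = t := Real.mul_self_sqrt ht.le
  simp only [Complex.coe_smul]
  constructor
  · rintro ⟨U, hU, rfl⟩
    refine ⟨√t • U.submatrix id (Fin.castLE hk), ?_, ?_⟩
    · rw [conjTranspose_smul, Matrix.smul_mul, Matrix.mul_smul, smul_smul, conjTranspose_submatrix,
        ← submatrix_mul _ _ _ id _ Function.bijective_id, ← star_eq_conjTranspose,
        Matrix.mem_unitaryGroup_iff'.mp hU, submatrix_one _ (Fin.castLE_injective hk),
        star_trivial, hsqrt]
    · rw [mul_diagonal_grassmannPattern_mul_star hk, conjTranspose_smul, Matrix.smul_mul,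
        Matrix.mul_smul, smul_smul, star_trivial, hsqrt, Complex.coe_smul]
  · rintro ⟨A, hA, rfl⟩
    have hV : ((√t)⁻¹ • A)ᴴ * ((√t)⁻¹ • A) = 1 := by
      rw [conjTranspose_smul, Matrix.smul_mul, Matrix.mul_smul, smul_smul, hA, smul_smul,
        star_trivial, ← mul_inv, hsqrt, inv_mul_cancel₀ ht.ne', one_smul]
    obtain ⟨U, hU, hUA⟩ := exists_mem_unitaryGroup_submatrix_eq hk hV
    refine ⟨U, hU, ?_⟩
    rw [mul_diagonal_grassmannPattern_mul_star hk, hUA, Complex.coe_smul, conjTranspose_smul,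
      Matrix.smul_mul, Matrix.mul_smul, smul_smul, smul_smul, star_trivial, mul_assoc, ← mul_inv,
      hsqrt, mul_inv_cancel₀ ht.ne', one_smul]

end Frames

/-! ### The Gelfand–Cetlin polytope -/

section Polytope

variable {n : ℕ}

/-- The value which `u` prescribes for the eigenvalue of index `k` (counted from `0`) of the leading
`j × j` submatrix, which is `u_{k+1,j-k}`; it is `0` when there is no such eigenvalue. -/
noncomputable def gcEntry (u : Index n → ℝ) (j k : ℕ) : ℝ :=
  if h : k < j ∧ j ≤ n then u ⟨(k + 1, j - k), by omega, by omega, by simp only; omega⟩ else 0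

theorem gcEntry_of_le (u : Index n → ℝ) {j k : ℕ} (h : j ≤ k) : gcEntry u j k = 0 :=
  dif_neg fun h' => by omega

theorem apply_eq_gcEntry (u : Index n → ℝ) (q : Index n) {j k : ℕ} (hk : q.1.1 = k + 1)
    (hj : q.1.1 + q.1.2 = j + 1) : u q = gcEntry u j k := by
  obtain ⟨⟨a, b⟩, ha, hb, hab⟩ := q
  obtain rfl : a = k + 1 := hk
  simp only at hj
  obtain rfl : b = j - k := by omega
  rw [gcEntry, dif_pos (by omega)]

/-- `gcEntry u j k` as a linear function of `u`. -/
noncomputable def gcEntryₗ (n j k : ℕ) : (Index n → ℝ) →ₗ[ℝ] ℝ where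
  toFun u := gcEntry u j k
  map_add' u v := by unfold gcEntry; split_ifs <;> simp
  map_smul' s u := by unfold gcEntry; split_ifs <;> simp

theorem gcEntryₗ_apply (u : Index n → ℝ) (j k : ℕ) : gcEntryₗ n j k u = gcEntry u j k := rfl

theorem mem_gcPolytope_iff {lam : Fin n → ℝ} {u : Index n → ℝ} :
    u ∈ gcPolytope lam ↔ (∀ i : Fin n, gcEntry u n i = lam i) ∧
      (∀ j k, k < j → j < n → gcEntry u j k ≤ gcEntry u (j + 1) k) ∧
      ∀ j k, k < j → j < n → gcEntry u (j + 1) (k + 1) ≤ gcEntry u j k := by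
  constructor
  · rintro ⟨hrow, hup, hdown⟩
    refine ⟨fun i => ?_, fun j k hk hj => ?_, fun j k hk hj => ?_⟩
    · rw [gcEntry, dif_pos ⟨i.2, le_rfl⟩]
      exact hrow _ i (by simp only; omega) rfl
    · rw [gcEntry, gcEntry, dif_pos ⟨hk, hj.le⟩, dif_pos (by omega)]
      exact hup _ _ rfl (by simp only; omega)
    · rw [gcEntry, gcEntry, dif_pos (by omega), dif_pos (by omega)]
      exact hdown _ _ rfl (by simp only; omega)
  · rintro ⟨hrow, hup, hdown⟩
    refine ⟨fun q i hq hi => ?_, fun q q' h₁ h₂ => ?_, fun q q' h₁ h₂ => ?_⟩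
    · rw [apply_eq_gcEntry u q hi hq, hrow]
    · obtain ⟨k, hk⟩ := Nat.exists_eq_add_of_le' q.2.1
      obtain ⟨b, hb⟩ := Nat.exists_eq_add_of_le' q.2.2.1
      have := q'.2
      rw [apply_eq_gcEntry u q hk (j := k + b + 1) (by omega),
        apply_eq_gcEntry u q' (h₁.trans hk) (j := k + b + 1 + 1) (by omega)]
      exact hup _ _ (by omega) (by omega)
    · obtain ⟨k, hk⟩ := Nat.exists_eq_add_of_le' q.2.1
      obtain ⟨b, hb⟩ := Nat.exists_eq_add_of_le' q.2.2.1
      have := q'.2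
      rw [apply_eq_gcEntry u q hk (j := k + b + 1) (by omega),
        apply_eq_gcEntry u q' (k := k + 1) (by omega) (j := k + b + 1 + 1) (by omega)]
      exact hdown _ _ (by omega) (by omega)

section Bounds

variable {lam : Fin n → ℝ} {u : Index n → ℝ} {j k : ℕ}

theorem gcEntry_succ_succ_le (hu : u ∈ gcPolytope lam) (hj : j < n) :
    gcEntry u (j + 1) (k + 1) ≤ gcEntry u j k := by
  rcases lt_or_ge k j with hk | hk
  · exact (mem_gcPolytope_iff.mp hu).2.2 j k hk hj
  · rw [gcEntry_of_le u hk, gcEntry_of_le u (Nat.succ_le_succ hk)]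

theorem gcEntry_antitoneOn (hu : u ∈ gcPolytope lam) (hj : j ≤ n) :
    AntitoneOn (gcEntry u j) (Set.Iio j) := by
  intro a _ b hb hab
  obtain ⟨j, rfl⟩ := Nat.exists_eq_add_one.mpr (pos_of_gt hb)
  induction b, hab using Nat.le_induction with
  | base => exact le_rfl
  | succ b _ ih =>
    have hb : b < j := Nat.succ_lt_succ_iff.mp hb
    calc gcEntry u (j + 1) (b + 1) ≤ gcEntry u j b := gcEntry_succ_succ_le hu hj
      _ ≤ gcEntry u (j + 1) b := (mem_gcPolytope_iff.mp hu).2.1 j b hb hj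
      _ ≤ gcEntry u (j + 1) a := ih (hb.trans j.lt_succ_self)

theorem gcEntry_le (hu : u ∈ gcPolytope lam) (hj : j ≤ n) {i : Fin n} (hi : (i : ℕ) < j) :
    gcEntry u j i ≤ lam i := by
  induction hj using Nat.decreasingInduction with
  | self => exact ((mem_gcPolytope_iff.mp hu).1 i).le
  | of_succ j hj ih =>
    exact ((mem_gcPolytope_iff.mp hu).2.1 j i hi hj).trans (ih (hi.trans j.lt_succ_self))

theorem le_gcEntry (hu : u ∈ gcPolytope lam) (hj : j ≤ n) (hk : k < j) {i : Fin n}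
    (hi : (i : ℕ) + j = k + n) : lam i ≤ gcEntry u j k := by
  induction hj using Nat.decreasingInduction generalizing k with
  | self =>
    obtain rfl : (i : ℕ) = k := by omega
    exact ((mem_gcPolytope_iff.mp hu).1 i).ge
  | of_succ j hj ih =>
    exact (ih (k := k + 1) (by omega) (by omega)).trans (gcEntry_succ_succ_le hu hj)

end Bounds

section Grassmann

variable {d j k : ℕ} {t : ℝ} {u : Index n → ℝ}

theorem gcEntry_nonneg (ht : 0 ≤ t) (hu : u ∈ gcPolytope (grassmannPattern d n t)) (j k : ℕ) :
    0 ≤ gcEntry u j k := by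
  by_cases h : k < j ∧ j ≤ n
  · refine le_trans ?_ (le_gcEntry hu h.2 h.1 (i := ⟨k + n - j, by omega⟩) (by simp only; omega))
    unfold grassmannPattern
    split_ifs <;> simp [ht]
  · rw [gcEntry, dif_neg h]

theorem gcEntry_le_of_grassmannPattern (ht : 0 ≤ t) (hu : u ∈ gcPolytope (grassmannPattern d n t))
    (j k : ℕ) : gcEntry u j k ≤ t := by
  by_cases h : k < j ∧ j ≤ n
  · refine (gcEntry_le hu h.2 (i := ⟨k, by omega⟩) h.1).trans ?_
    unfold grassmannPattern
    split_ifs <;> simp [ht]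
  · rwa [gcEntry, dif_neg h]

theorem gcEntry_eq_zero (ht : 0 ≤ t) (hu : u ∈ gcPolytope (grassmannPattern d n t)) (hk : d ≤ k) :
    gcEntry u j k = 0 := by
  refine le_antisymm ?_ (gcEntry_nonneg ht hu j k)
  by_cases h : k < j ∧ j ≤ n
  · exact (gcEntry_le hu h.2 (i := ⟨k, by omega⟩) h.1).trans_eq (if_neg hk.not_gt)
  · rw [gcEntry, dif_neg h]

theorem gcEntry_eq_of_lt (ht : 0 ≤ t) (hu : u ∈ gcPolytope (grassmannPattern d n t)) (hj : j ≤ n)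
    (hk : k < j) (hjk : k + n < j + d) : gcEntry u j k = t := by
  refine le_antisymm (gcEntry_le_of_grassmannPattern ht hu j k) ?_
  refine (if_pos ?_).ge.trans
    (le_gcEntry hu hj hk (i := ⟨k + n - j, by omega⟩) (by simp only; omega))
  simp only
  omega

theorem gcEntry_succ_right_le (ht : 0 ≤ t) (hu : u ∈ gcPolytope (grassmannPattern d n t))
    (hj : j ≤ n) : gcEntry u j (k + 1) ≤ gcEntry u j k := by
  rcases lt_or_ge (k + 1) j with hk | hk
  · exact gcEntry_antitoneOn hu hj (Set.mem_Iio.mpr (Nat.lt_of_succ_lt hk)) hk k.le_succ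
  · rw [gcEntry_of_le u hk]
    exact gcEntry_nonneg ht hu _ _

theorem gcEntry_le_succ (ht : 0 ≤ t) (hu : u ∈ gcPolytope (grassmannPattern d n t)) (hj : j < n) :
    gcEntry u j k ≤ gcEntry u (j + 1) k := by
  rcases lt_or_ge k j with hk | hk
  · exact (mem_gcPolytope_iff.mp hu).2.1 j k hk hj
  · rw [gcEntry_of_le u hk]
    exact gcEntry_nonneg ht hu _ _

end Grassmann

end Polytope

/-! ### Gelfand–Cetlin coordinates as characteristic polynomials -/

section Coordinates

open Matrix Polynomial

theorem eq_of_antitone_of_map_univ_eq {α : Type*} [LinearOrder α] {m : ℕ} {f g : Fin m → α}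
    (hf : Antitone f) (hg : Antitone g)
    (h : (Finset.univ : Finset (Fin m)).val.map f = (Finset.univ : Finset (Fin m)).val.map g) :
    f = g := by
  rw [Fin.univ_val_map, Fin.univ_val_map, Multiset.coe_eq_coe] at h
  exact List.ofFn_injective (h.eq_of_sortedGE hf.sortedGE_ofFn hg.sortedGE_ofFn)

section Spectrum

variable {𝕜 ι : Type*} [RCLike 𝕜] [Fintype ι]

theorem prod_X_sub_C_ofReal_inj {m : ℕ} {f g : Fin m → ℝ} (hf : Antitone f) (hg : Antitone g) :
    ∏ k, (X - C (f k : 𝕜)) = ∏ k, (X - C (g k : 𝕜)) ↔ f = g := by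
  refine ⟨fun h => ?_, fun h => by rw [h]⟩
  refine eq_of_antitone_of_map_univ_eq hf hg
    (Multiset.map_injective (RCLike.ofReal_injective (K := 𝕜)) ?_)
  have hroots (e : Fin m → ℝ) : (∏ k, (X - C (e k : 𝕜))).roots =
      ((Finset.univ : Finset (Fin m)).val.map e).map RCLike.ofReal := by
    rw [Multiset.map_map, ← roots_multiset_prod_X_sub_C (Finset.univ.val.map (_ ∘ e)),
      Multiset.map_map]
    rfl
  rw [← hroots, h, hroots]

variable [DecidableEq ι] {y : Matrix ι ι 𝕜}

theorem charpoly_eq_prod_eigenvalues₀ (hy : y.IsHermitian) :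
    y.charpoly = ∏ k, (X - C (hy.eigenvalues₀ k : 𝕜)) := by
  rw [hy.charpoly_eq]
  exact Equiv.prod_comp (Fintype.equivOfCardEq (Fintype.card_fin (Fintype.card ι))).symm
    fun k => X - C (hy.eigenvalues₀ k : 𝕜)

theorem eigenvalues₀_eq_iff (hy : y.IsHermitian) {ev : Fin (Fintype.card ι) → ℝ}
    (hev : Antitone ev) :
    hy.eigenvalues₀ = ev ↔ y.charpoly = ∏ k, (X - C (ev k : 𝕜)) := by
  rw [charpoly_eq_prod_eigenvalues₀ hy, prod_X_sub_C_ofReal_inj hy.eigenvalues₀_antitone hev]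

end Spectrum

variable {n : ℕ}

theorem eigenvalues₀_eq_gcEntry_iff {lam : Fin n → ℝ} {u : Index n → ℝ} (hu : u ∈ gcPolytope lam)
    {j : ℕ} (hj : j ≤ n) {y : Mat j} (hy : y.IsHermitian) :
    (∀ k, hy.eigenvalues₀ k = gcEntry u j k) ↔
      y.charpoly = ∏ k ∈ Finset.range j, (X - C (gcEntry u j k : ℂ)) := by
  have hlt (k : Fin (Fintype.card (Fin j))) : (k : ℕ) < j := by simpa using k.2
  have hanti : Antitone fun k : Fin (Fintype.card (Fin j)) => gcEntry u j k :=
    fun a b hab => gcEntry_antitoneOn hu hj (hlt a) (hlt b) hab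
  have hrange : Finset.range j = Finset.range (Fintype.card (Fin j)) := by rw [Fintype.card_fin]
  rw [← funext_iff, eigenvalues₀_eq_iff hy hanti, hrange,
    ← Fin.prod_univ_eq_prod_range fun k => X - C (gcEntry u j k : ℂ)]
  rfl

theorem gcMap_apply {lam : Fin n → ℝ} (x : orbit lam) (q : Index n) {j : ℕ} (hj : j ≤ n)
    (hq : q.1.1 + q.1.2 = j + 1) :
    gcMap x q = ((orbit_isHermitian x).submatrix (Fin.castLE hj)).eigenvalues₀
      ⟨q.1.1 - 1, by have := q.2; rw [Fintype.card_fin]; omega⟩ := by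
  obtain rfl : j = q.1.1 + q.1.2 - 1 := by omega
  rfl

theorem gcMap_eq_iff_eigenvalues₀ {lam : Fin n → ℝ} {u : Index n → ℝ} (x : orbit lam) :
    gcMap x = u ↔ ∀ j (hj : j ≤ n) k,
      ((orbit_isHermitian x).submatrix (Fin.castLE hj)).eigenvalues₀ k = gcEntry u j k := by
  constructor
  · rintro rfl j hj k
    have hk : (k : ℕ) < j := by simpa using k.2
    rw [gcEntry, dif_pos ⟨hk, hj⟩, gcMap_apply x _ hj (by simp only; omega)]
    rfl
  · intro h
    funext q
    have := q.2
    rw [gcMap_apply x q (j := q.1.1 + q.1.2 - 1) (by omega) (by omega), h]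
    exact (apply_eq_gcEntry u q (by simp only; omega) (by omega)).symm

theorem gcMap_eq_iff_charpoly {lam : Fin n → ℝ} {u : Index n → ℝ} (hu : u ∈ gcPolytope lam)
    (x : orbit lam) :
    gcMap x = u ↔ ∀ j (hj : j ≤ n),
      ((x : Mat n).submatrix (Fin.castLE hj) (Fin.castLE hj)).charpoly =
        ∏ k ∈ Finset.range j, (X - C (gcEntry u j k : ℂ)) := by
  rw [gcMap_eq_iff_eigenvalues₀]
  exact forall₂_congr fun j hj => eigenvalues₀_eq_gcEntry_iff hu hj _

theorem isClosed_gcFiber {lam : Fin n → ℝ} {u : Index n → ℝ} (hu : u ∈ gcPolytope lam) :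
    IsClosed (gcFiber lam u) := by
  have h : gcFiber lam u = {x : orbit lam | ∀ j (hj : j ≤ n) (z : ℂ),
      (((x : Mat n).submatrix (Fin.castLE hj) (Fin.castLE hj)).charpoly).eval z =
        (∏ k ∈ Finset.range j, (X - C (gcEntry u j k : ℂ))).eval z} := by
    ext x
    simp only [gcFiber, Set.mem_ofPred_eq, gcMap_eq_iff_charpoly hu]
    exact forall₂_congr fun j hj => ⟨fun h z => by rw [h], Polynomial.funext⟩
  rw [h]
  simp only [Set.ofPred_forall, eval_charpoly]
  refine isClosed_iInter fun j => isClosed_iInter fun hj => isClosed_iInter fun z =>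
    isClosed_eq ?_ continuous_const
  fun_prop

section Frame

variable {ι : Type*}

/-- The matrix `A` with the rows from the `j`-th on replaced by zero. -/
def firstRows (A : Matrix (Fin n) ι ℂ) (j : ℕ) : Matrix (Fin n) ι ℂ :=
  Matrix.of fun i c => if (i : ℕ) < j then A i c else 0

/-- The Gram matrix of the columns of the first `j` rows of `A`. -/
def frameGram (A : Matrix (Fin n) ι ℂ) (j : ℕ) : Matrix ι ι ℂ :=
  (firstRows A j)ᴴ * firstRows A j

theorem sum_fin_ite_lt {M : Type*} [AddCommMonoid M] {j : ℕ} (hj : j ≤ n) (f : Fin n → M) :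
    ∑ i : Fin n, (if (i : ℕ) < j then f i else 0) = ∑ i : Fin j, f (Fin.castLE hj i) := by
  obtain ⟨m, rfl⟩ := Nat.exists_eq_add_of_le hj
  simp only [Fin.sum_univ_add, Fin.val_castAdd, Fin.is_lt, if_true, Fin.val_natAdd,
    Nat.not_lt.mpr (Nat.le_add_right j _), if_false, Finset.sum_const_zero, add_zero]
  rfl

theorem frameGram_eq_submatrix (A : Matrix (Fin n) ι ℂ) {j : ℕ} (hj : j ≤ n) :
    frameGram A j = (A.submatrix (Fin.castLE hj) id)ᴴ * A.submatrix (Fin.castLE hj) id := by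
  ext a b
  simp only [frameGram, mul_apply, conjTranspose_apply, firstRows, of_apply, submatrix_apply, id_eq,
    ← sum_fin_ite_lt hj fun i => star (A i a) * A i b]
  refine Finset.sum_congr rfl fun i _ => ?_
  split_ifs <;> simp only [mul_zero]

theorem charpoly_submatrix_mul_X_pow [Fintype ι] [DecidableEq ι] (A : Matrix (Fin n) ι ℂ) {j : ℕ}
    (hj : j ≤ n) :
    ((A * Aᴴ).submatrix (Fin.castLE hj) (Fin.castLE hj)).charpoly * X ^ Fintype.card ι =
      (frameGram A j).charpoly * X ^ j := by
  have hsub : (A * Aᴴ).submatrix (Fin.castLE hj) (Fin.castLE hj) =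
      A.submatrix (Fin.castLE hj) id * (A.submatrix (Fin.castLE hj) id)ᴴ := by
    rw [conjTranspose_submatrix, submatrix_mul A Aᴴ _ id _ Function.bijective_id]
  have h := charpoly_mul_comm' (A.submatrix (Fin.castLE hj) id) (A.submatrix (Fin.castLE hj) id)ᴴ
  rw [Fintype.card_fin] at h
  rw [hsub, frameGram_eq_submatrix A hj, mul_comm, h, mul_comm]

theorem prod_range_X_sub_C_mul_X_pow {R : Type*} [CommRing R] {f : ℕ → R} {a : ℕ}
    (hf : ∀ k, a ≤ k → f k = 0) (b : ℕ) :
    (∏ k ∈ Finset.range a, (X - C (f k))) * X ^ b = ∏ k ∈ Finset.range (a + b), (X - C (f k)) := by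
  rw [Finset.prod_range_add, ← Finset.card_range b, ← Finset.prod_const, Finset.card_range]
  congr 1
  exact Finset.prod_congr rfl fun k _ => by rw [hf _ (Nat.le_add_right a k), C_0, sub_zero]

theorem gcMap_eq_iff_charpoly_frameGram {d : ℕ} {t : ℝ} {u : Index n → ℝ} (ht : 0 ≤ t)
    (hu : u ∈ gcPolytope (grassmannPattern d n t)) (x : orbit (grassmannPattern d n t))
    {A : Matrix (Fin n) (Fin d) ℂ} (hx : (x : Mat n) = A * Aᴴ) :
    gcMap x = u ↔ ∀ j ≤ n,
      (frameGram A j).charpoly = ∏ c : Fin d, (X - C (gcEntry u j c : ℂ)) := by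
  rw [gcMap_eq_iff_charpoly hu, hx]
  refine forall₂_congr fun j hj => ?_
  have hpad : (∏ k ∈ Finset.range j, (X - C (gcEntry u j k : ℂ))) * X ^ d =
      (∏ c : Fin d, (X - C (gcEntry u j c : ℂ))) * X ^ j := by
    rw [Fin.prod_univ_eq_prod_range (fun k => X - C (gcEntry u j k : ℂ)),
      prod_range_X_sub_C_mul_X_pow, prod_range_X_sub_C_mul_X_pow, add_comm]
    · intro k hk
      rw [gcEntry_eq_zero ht hu hk, Complex.ofReal_zero]
    · intro k hk
      rw [gcEntry_of_le u hk, Complex.ofReal_zero]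
  have hgram := charpoly_submatrix_mul_X_pow A hj
  rw [Fintype.card_fin] at hgram
  rw [← mul_left_inj' (pow_ne_zero d X_ne_zero), hpad, hgram,
    mul_left_inj' (pow_ne_zero j X_ne_zero)]

end Frame

theorem charpoly_fin_two_eq_iff {R : Type*} [CommRing R] [Nontrivial R]
    (B : Matrix (Fin 2) (Fin 2) R) (a b : R) :
    B.charpoly = (X - C a) * (X - C b) ↔ B.trace = a + b ∧ B.det = a * b := by
  have hexpand : (X - C a) * (X - C b) = X ^ 2 - C (a + b) * X + C (a * b) := by
    simp only [C_add, C_mul]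
    ring
  rw [charpoly_fin_two, hexpand]
  constructor
  · intro h
    have hdet : B.det = a * b := by simpa using congrArg (coeff · 0) h
    have htrace : -B.trace = -b + -a := by simpa [coeff_X] using congrArg (coeff · 1) h
    exact ⟨by linear_combination -htrace, hdet⟩
  · rintro ⟨htrace, hdet⟩
    rw [htrace, hdet]

theorem gcMap_eq_iff_trace_det {t : ℝ} {u : Index n → ℝ} (ht : 0 ≤ t)
    (hu : u ∈ gcPolytope (grassmannPattern 2 n t)) (x : orbit (grassmannPattern 2 n t))
    {A : Matrix (Fin n) (Fin 2) ℂ} (hx : (x : Mat n) = A * Aᴴ) :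
    gcMap x = u ↔ ∀ j ≤ n,
      (frameGram A j).trace = (gcEntry u j 0 : ℂ) + gcEntry u j 1 ∧
        (frameGram A j).det = (gcEntry u j 0 : ℂ) * gcEntry u j 1 := by
  simp only [gcMap_eq_iff_charpoly_frameGram ht hu x hx, Fin.prod_univ_two, Fin.val_zero,
    Fin.val_one, charpoly_fin_two_eq_iff]

end Coordinates

/-! ### The polygon of a frame -/

section FramePolygon

open Matrix

variable {n : ℕ}

theorem map_vertex {M N : Type*} [AddCommMonoid M] [AddCommMonoid N] (f : M →+ N) (e : ℕ → M)
    (j : ℕ) : f (vertex e j) = vertex (f ∘ e) j :=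
  map_sum f e _

theorem frameGram_eq_vertex {ι : Type*} [NeZero n] (A : Matrix (Fin n) ι ℂ) {j : ℕ} (hj : j ≤ n) :
    frameGram A j = vertex (periodize fun i => vecMulVec (star (A i)) (A i)) j := by
  ext a b
  rw [frameGram_eq_submatrix A hj, vertex, ← Fin.sum_univ_eq_sum_range, Matrix.sum_apply, mul_apply]
  refine Finset.sum_congr rfl fun i _ => ?_
  rw [← Fin.val_castLE hj, periodize_val]
  rfl

theorem isHermitian_frameGram {ι : Type*} (A : Matrix (Fin n) ι ℂ) (j : ℕ) :
    (frameGram A j).IsHermitian :=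
  isHermitian_conjTranspose_mul_self _

theorem frameGram_self {ι : Type*} (A : Matrix (Fin n) ι ℂ) : frameGram A n = Aᴴ * A := by
  rw [frameGram_eq_submatrix A le_rfl]
  rfl

/-- The Bloch vector of a Hermitian `2 × 2` matrix: its traceless part, as a point of a
three-dimensional Euclidean space, scaled so that its length is the gap between the eigenvalues. -/
noncomputable def blochVector : Matrix (Fin 2) (Fin 2) ℂ →ₗ[ℝ] WithLp 2 (ℝ × ℂ) where
  toFun G := WithLp.toLp 2 ((G 0 0).re - (G 1 1).re, 2 * G 0 1)
  map_add' G G' := by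
    rw [← WithLp.toLp_add]
    congr 1
    ext1 <;> simp <;> ring
  map_smul' s G := by
    rw [← WithLp.toLp_smul]
    congr 1
    ext1 <;> simp <;> ring

theorem norm_blochVector_sq {G : Matrix (Fin 2) (Fin 2) ℂ} (hG : G.IsHermitian) :
    ((‖blochVector G‖ ^ 2 : ℝ) : ℂ) = G.trace ^ 2 - 4 * G.det := by
  have hoff : G 0 1 * G 1 0 = (‖G 0 1‖ ^ 2 : ℝ) := by
    rw [← hG.apply 1 0, Complex.star_def, Complex.mul_conj, Complex.normSq_eq_norm_sq]
  have hnorm : ‖blochVector G‖ ^ 2 = ((G 0 0).re - (G 1 1).re) ^ 2 + 4 * ‖G 0 1‖ ^ 2 := by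
    rw [WithLp.prod_norm_sq_eq_of_L2]
    simp only [blochVector, LinearMap.coe_mk, AddHom.coe_mk, WithLp.toLp_fst, WithLp.toLp_snd,
      norm_mul, Real.norm_eq_abs, sq_abs, Complex.norm_ofNat]
    ring
  have hdiag (a : Fin 2) : ((G a a).re : ℂ) = G a a := hG.coe_re_apply_self a
  rw [hnorm, trace_fin_two, det_fin_two, hoff]
  push_cast
  rw [hdiag, hdiag]
  ring

/-- The edge attached to the `i`-th row of a frame with two columns: the Bloch vector of the
Hermitian matrix of rank one given by this row. -/
noncomputable def rowEdge (A : Matrix (Fin n) (Fin 2) ℂ) (i : Fin n) : WithLp 2 (ℝ × ℂ) :=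
  blochVector (vecMulVec (star (A i)) (A i))

theorem norm_rowEdge (A : Matrix (Fin n) (Fin 2) ℂ) (i : Fin n) :
    (‖rowEdge A i‖ : ℂ) = (vecMulVec (star (A i)) (A i)).trace := by
  have hpos : 0 ≤ ‖A i 0‖ ^ 2 + ‖A i 1‖ ^ 2 := by positivity
  have htrace : (vecMulVec (star (A i)) (A i)).trace = ((‖A i 0‖ ^ 2 + ‖A i 1‖ ^ 2 : ℝ) : ℂ) := by
    simp only [trace_fin_two, vecMulVec_apply, Pi.star_apply, Complex.star_def, Complex.conj_mul']
    push_cast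
    rfl
  have hsq := norm_blochVector_sq (G := vecMulVec (star (A i)) (A i))
    (by rw [IsHermitian, conjTranspose_vecMulVec, star_star])
  rw [det_vecMulVec, mul_zero, sub_zero, htrace] at hsq
  rw [htrace, rowEdge, Complex.ofReal_inj, ← sq_eq_sq₀ (norm_nonneg _) hpos]
  exact_mod_cast hsq

section

variable [NeZero n] (A : Matrix (Fin n) (Fin 2) ℂ) {j : ℕ}

theorem vertex_rowEdge (hj : j ≤ n) :
    vertex (periodize (rowEdge A)) j = blochVector (frameGram A j) := by
  rw [frameGram_eq_vertex A hj]
  exact (map_vertex blochVector.toAddMonoidHom _ j).symm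

theorem vertex_norm_rowEdge (hj : j ≤ n) :
    ((vertex (fun i => ‖periodize (rowEdge A) i‖) j : ℝ) : ℂ) = (frameGram A j).trace := by
  rw [frameGram_eq_vertex A hj]
  refine (map_vertex Complex.ofRealHom.toAddMonoidHom _ j).trans
    (.trans ?_ (map_vertex (traceAddMonoidHom (Fin 2) ℂ) _ j).symm)
  exact congrArg (vertex · j) (funext fun i => norm_rowEdge A _)

end

section Coordinates

variable [NeZero n] {t : ℝ} {u : Index n → ℝ} {x : orbit (grassmannPattern 2 n t)}
  {A : Matrix (Fin n) (Fin 2) ℂ} {j : ℕ}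

theorem norm_vertex_rowEdge (ht : 0 ≤ t) (hu : u ∈ gcPolytope (grassmannPattern 2 n t))
    (hx : (x : Mat n) = A * Aᴴ) (hxu : gcMap x = u) (hj : j ≤ n) :
    ‖vertex (periodize (rowEdge A)) j‖ = gcEntry u j 0 - gcEntry u j 1 := by
  obtain ⟨htrace, hdet⟩ := (gcMap_eq_iff_trace_det ht hu x hx).mp hxu j hj
  have hsq := norm_blochVector_sq (isHermitian_frameGram A j)
  rw [htrace, hdet] at hsq
  have hnonneg := sub_nonneg.mpr (gcEntry_succ_right_le (k := 0) ht hu hj)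
  rw [vertex_rowEdge A hj, ← sq_eq_sq₀ (norm_nonneg _) hnonneg, ← Complex.ofReal_inj, hsq]
  push_cast
  ring

theorem norm_periodize_rowEdge (ht : 0 ≤ t) (hu : u ∈ gcPolytope (grassmannPattern 2 n t))
    (hx : (x : Mat n) = A * Aᴴ) (hxu : gcMap x = u) (hj : j < n) :
    ‖periodize (rowEdge A) j‖ =
      gcEntry u (j + 1) 0 + gcEntry u (j + 1) 1 - (gcEntry u j 0 + gcEntry u j 1) := by
  have hperimeter {i : ℕ} (hi : i ≤ n) :
      vertex (fun i => ‖periodize (rowEdge A) i‖) i = gcEntry u i 0 + gcEntry u i 1 := by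
    rw [← Complex.ofReal_inj, vertex_norm_rowEdge A hi,
      ((gcMap_eq_iff_trace_det ht hu x hx).mp hxu i hi).1, Complex.ofReal_add]
  rw [← hperimeter hj, ← hperimeter hj.le, vertex_succ, add_sub_cancel_left]

theorem shrinks_rowEdge_iff (ht : 0 ≤ t) (hu : u ∈ gcPolytope (grassmannPattern 2 n t))
    (hx : (x : Mat n) = A * Aᴴ) (hxu : gcMap x = u) (hj : j < n) :
    Shrinks (periodize (rowEdge A)) j ↔ gcEntry u (j + 1) 0 = gcEntry u j 0 := by
  rw [Shrinks, norm_vertex_rowEdge ht hu hx hxu hj.le, norm_vertex_rowEdge ht hu hx hxu hj,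
    norm_periodize_rowEdge ht hu hx hxu hj]
  constructor <;> intro h <;> linarith

theorem grows_rowEdge_iff (ht : 0 ≤ t) (hu : u ∈ gcPolytope (grassmannPattern 2 n t))
    (hx : (x : Mat n) = A * Aᴴ) (hxu : gcMap x = u) (hj : j < n) :
    Grows (periodize (rowEdge A)) j ↔ gcEntry u (j + 1) 1 = gcEntry u j 1 := by
  rw [Grows, norm_vertex_rowEdge ht hu hx hxu hj.le, norm_vertex_rowEdge ht hu hx hxu hj,
    norm_periodize_rowEdge ht hu hx hxu hj]
  constructor <;> intro h <;> linarith

theorem folds_rowEdge_iff (ht : 0 ≤ t) (hu : u ∈ gcPolytope (grassmannPattern 2 n t))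
    (hx : (x : Mat n) = A * Aᴴ) (hxu : gcMap x = u) (hj : j < n) :
    Folds (periodize (rowEdge A)) j ↔ gcEntry u (j + 1) 1 = gcEntry u j 0 := by
  rw [Folds, norm_vertex_rowEdge ht hu hx hxu hj.le, norm_vertex_rowEdge ht hu hx hxu hj,
    norm_periodize_rowEdge ht hu hx hxu hj]
  constructor <;> intro h <;> linarith

theorem sum_rowEdge_eq_zero (hA : Aᴴ * A = (t : ℂ) • 1) : ∑ i, rowEdge A i = 0 := by
  rw [← vertex_periodize_self, vertex_rowEdge A le_rfl, frameGram_self, hA]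
  simp [blochVector]

theorem rowEdge_ne_zero (ht : t ≠ 0) (hA : Aᴴ * A = (t : ℂ) • 1) : rowEdge A ≠ 0 := by
  intro h
  have htrace := vertex_norm_rowEdge A le_rfl
  rw [h, frameGram_self, hA] at htrace
  simp [vertex, periodize, ht] at htrace

end Coordinates

theorem coe_permAct {lam : Fin n → ℝ} (w : Equiv.Perm (Fin n)) (x : orbit lam) :
    (permAct w x : Mat n) = (x : Mat n).submatrix w w := by
  change w.permMatrix ℂ * (x : Mat n) * star (w.permMatrix ℂ) = _
  rw [star_eq_conjTranspose, conjTranspose_permMatrix, Equiv.Perm.permMatrix,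
    Equiv.Perm.permMatrix, PEquiv.toMatrix_toPEquiv_mul, PEquiv.mul_toMatrix_toPEquiv]
  rfl

theorem coe_permAct_of_frame {lam : Fin n → ℝ} {ι : Type*} [Fintype ι] {x : orbit lam}
    {A : Matrix (Fin n) ι ℂ} (w : Equiv.Perm (Fin n)) (hx : (x : Mat n) = A * Aᴴ) :
    (permAct w x : Mat n) = A.submatrix w id * (A.submatrix w id)ᴴ := by
  rw [coe_permAct, hx, conjTranspose_submatrix,
    submatrix_mul A Aᴴ _ id _ Function.bijective_id]

end FramePolygon

/-! ### Relative interiors and proper faces -/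

section Extension

variable {E : Type*} [AddCommGroup E] [Module ℝ E] [TopologicalSpace E] {f : Set E} {u v : E}

theorem exists_add_smul_sub_mem_of_mem_intrinsicInterior [IsTopologicalAddGroup E]
    [ContinuousSMul ℝ E] (hu : u ∈ intrinsicInterior ℝ f) (hv : v ∈ f) :
    ∃ s : ℝ, 0 < s ∧ u + s • (u - v) ∈ f := by
  obtain ⟨y, hy, rfl⟩ := hu
  have hmem (s : ℝ) : (y : E) + s • ((y : E) - v) ∈ affineSpan ℝ f := by
    convert AffineMap.lineMap_mem (-s) y.2 (subset_affineSpan ℝ f hv) using 1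
    rw [AffineMap.lineMap_apply_module']
    module
  let c : ℝ → affineSpan ℝ f := fun s => ⟨(y : E) + s • ((y : E) - v), hmem s⟩
  have hc : Continuous c := Continuous.subtype_mk (by fun_prop) _
  have hc0 : c 0 = y := Subtype.ext (by simp [c])
  have hev : ∀ᶠ s in nhds (0 : ℝ), c s ∈ interior (((↑) : affineSpan ℝ f → E) ⁻¹' f) :=
    hc.continuousAt.eventually_mem (by rw [hc0]; exact isOpen_interior.mem_nhds hy)
  obtain ⟨s, hs, hpos⟩ := ((hev.filter_mono nhdsWithin_le_nhds).and
    (self_mem_nhdsWithin (s := Set.Ioi 0))).exists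
  exact ⟨s, hpos, interior_subset (s := ((↑) : affineSpan ℝ f → E) ⁻¹' f) hs⟩

theorem map_eq_zero_of_mem_intrinsicInterior [IsTopologicalAddGroup E] [ContinuousSMul ℝ E]
    {l : E →ₗ[ℝ] ℝ} (hl : ∀ v ∈ f, 0 ≤ l v) (hu : u ∈ intrinsicInterior ℝ f) (h0 : l u = 0)
    (hv : v ∈ f) : l v = 0 := by
  obtain ⟨s, hs, hmem⟩ := exists_add_smul_sub_mem_of_mem_intrinsicInterior hu hv
  have h := hl _ hmem
  rw [map_add, map_smul, map_sub, h0, zero_add, zero_sub, smul_eq_mul,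
    mul_nonneg_iff_of_pos_left hs, neg_nonneg] at h
  exact h.antisymm (hl v hv)

theorem eq_of_isExposed_of_forall_exists_add_smul_sub_mem {P : Set E} (hf : IsExposed ℝ P f)
    (hu : u ∈ f) (h : ∀ v ∈ P, ∃ s : ℝ, 0 < s ∧ u + s • (u - v) ∈ P) : f = P := by
  obtain ⟨l, rfl⟩ := hf ⟨u, hu⟩
  refine (Set.sep_subset _ _).antisymm fun v hv => ⟨hv, fun y hy => (hu.2 y hy).trans ?_⟩
  obtain ⟨s, hs, hmem⟩ := h v hv
  have hle := hu.2 _ hmem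
  rw [map_add, map_smul, map_sub, smul_eq_mul, add_le_iff_nonpos_right] at hle
  exact sub_nonpos.mp (nonpos_of_mul_nonpos_right hle hs)

end Extension

theorem eventually_nonneg_add_smul_sub {E : Type*} [AddCommGroup E] [Module ℝ E]
    {u v : E} (l : E →ₗ[ℝ] ℝ) (h : 0 < l u ∨ l u = 0 ∧ l v = 0) :
    ∀ᶠ s in nhdsWithin (0 : ℝ) (Set.Ioi 0), 0 ≤ l (u + s • (u - v)) := by
  simp only [map_add, map_smul, map_sub, smul_eq_mul]
  rcases h with h | ⟨hu, hv⟩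
  · refine Filter.Eventually.filter_mono nhdsWithin_le_nhds ?_
    have hcont : ContinuousAt (fun s : ℝ => l u + s * (l u - l v)) 0 := by fun_prop
    exact (hcont.eventually_const_lt (by simpa using h)).mono fun s hs => hs.le
  · exact Filter.Eventually.of_forall fun s => by rw [hu, hv, sub_zero, mul_zero, add_zero]

section ProperFaces

variable {n : ℕ} {t : ℝ} {u v : Index n → ℝ}

/-- `u` satisfies with equality one of the inequalities between the first two rows that are not
equalities on the whole polytope. -/
def IsDegenerate (u : Index n → ℝ) : Prop :=
  ∃ j, 1 ≤ j ∧ j + 2 ≤ n ∧ (gcEntry u (j + 1) 0 = gcEntry u j 0 ∨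
    gcEntry u (j + 1) 1 = gcEntry u j 1 ∨ gcEntry u (j + 1) 1 = gcEntry u j 0)

theorem lt_of_not_isDegenerate (ht : 0 ≤ t) (hu : u ∈ gcPolytope (grassmannPattern 2 n t))
    (hd : ¬ IsDegenerate u) {j : ℕ} (hj : 1 ≤ j) (hjn : j + 2 ≤ n) :
    gcEntry u j 0 < gcEntry u (j + 1) 0 ∧ gcEntry u j 1 < gcEntry u (j + 1) 1 ∧
      gcEntry u (j + 1) 1 < gcEntry u j 0 := by
  have hne : ¬ (gcEntry u (j + 1) 0 = gcEntry u j 0 ∨ gcEntry u (j + 1) 1 = gcEntry u j 1 ∨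
    gcEntry u (j + 1) 1 = gcEntry u j 0) := fun h => hd ⟨j, hj, hjn, h⟩
  push Not at hne
  exact ⟨lt_of_le_of_ne (gcEntry_le_succ ht hu (by omega)) hne.1.symm,
    lt_of_le_of_ne (gcEntry_le_succ ht hu (by omega)) hne.2.1.symm,
    lt_of_le_of_ne (gcEntry_succ_succ_le hu (by omega)) hne.2.2⟩

theorem gcEntry_one_lt_of_not_isDegenerate (ht : 0 < t)
    (hu : u ∈ gcPolytope (grassmannPattern 2 n t)) (hd : ¬ IsDegenerate u) {j : ℕ} (hj : j < n) :
    gcEntry u j 1 < t := by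
  rcases le_or_gt j 1 with h1 | h1
  · rwa [gcEntry_of_le u h1]
  · obtain ⟨j, rfl⟩ := Nat.exists_eq_add_of_le' h1
    exact (lt_of_not_isDegenerate ht.le hu hd (by omega) hj).2.2.trans_le
      (gcEntry_le_of_grassmannPattern ht.le hu _ _)

theorem gcEntry_one_lt_gcEntry_zero_of_not_isDegenerate (ht : 0 < t)
    (hu : u ∈ gcPolytope (grassmannPattern 2 n t)) (hd : ¬ IsDegenerate u) {j : ℕ} (h1 : 1 ≤ j)
    (hj : j < n) : gcEntry u j 1 < gcEntry u j 0 := by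
  rcases le_or_gt (j + 2) n with hjn | hjn
  · obtain ⟨-, hlt, hlt'⟩ := lt_of_not_isDegenerate ht.le hu hd h1 hjn
    exact hlt.trans hlt'
  · rw [gcEntry_eq_of_lt ht.le hu hj.le (k := 0) (by omega) (by omega)]
    exact gcEntry_one_lt_of_not_isDegenerate ht hu hd hj

theorem gcEntry_lt_succ_or_eq (ht : 0 < t) (hu : u ∈ gcPolytope (grassmannPattern 2 n t))
    (hd : ¬ IsDegenerate u) {j k : ℕ} (hk : k < j) (hj : j < n) :
    gcEntry u j k < gcEntry u (j + 1) k ∨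
      ∀ v ∈ gcPolytope (grassmannPattern 2 n t), gcEntry v (j + 1) k = gcEntry v j k := by
  match k with
  | 0 =>
    rcases le_or_gt (j + 2) n with hjn | hjn
    · exact .inl (lt_of_not_isDegenerate ht.le hu hd hk hjn).1
    · refine .inr fun v hv => ?_
      rw [gcEntry_eq_of_lt ht.le hv hj (by omega) (by omega),
        gcEntry_eq_of_lt ht.le hv hj.le hk (by omega)]
  | 1 =>
    refine .inl ?_
    rcases le_or_gt (j + 2) n with hjn | hjn
    · exact (lt_of_not_isDegenerate ht.le hu hd (by omega) hjn).2.1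
    · rw [gcEntry_eq_of_lt ht.le hu hj (by omega) (by omega)]
      exact gcEntry_one_lt_of_not_isDegenerate ht hu hd hj
  | k + 2 =>
    refine .inr fun v hv => ?_
    rw [gcEntry_eq_zero ht.le hv (by omega), gcEntry_eq_zero ht.le hv (by omega)]

theorem gcEntry_succ_succ_lt_or_eq (ht : 0 < t) (hu : u ∈ gcPolytope (grassmannPattern 2 n t))
    (hd : ¬ IsDegenerate u) {j k : ℕ} (hk : k < j) (hj : j < n) :
    gcEntry u (j + 1) (k + 1) < gcEntry u j k ∨
      ∀ v ∈ gcPolytope (grassmannPattern 2 n t), gcEntry v j k = gcEntry v (j + 1) (k + 1) := by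
  match k with
  | 0 =>
    rcases le_or_gt (j + 2) n with hjn | hjn
    · exact .inl (lt_of_not_isDegenerate ht.le hu hd hk hjn).2.2
    · refine .inr fun v hv => ?_
      rw [gcEntry_eq_of_lt ht.le hv hj (by omega) (by omega),
        gcEntry_eq_of_lt ht.le hv hj.le hk (by omega)]
  | 1 =>
    obtain ⟨j, rfl⟩ := Nat.exists_eq_add_of_le' hk
    rw [gcEntry_eq_zero ht.le hu (k := 1 + 1) le_rfl]
    exact .inl ((gcEntry_nonneg ht.le hu _ _).trans_lt
      (lt_of_not_isDegenerate ht.le hu hd (j := j + 1) (by omega) (by omega)).2.1)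
  | k + 2 =>
    refine .inr fun v hv => ?_
    rw [gcEntry_eq_zero ht.le hv (by omega), gcEntry_eq_zero ht.le hv (by omega)]

theorem exists_add_smul_sub_mem_of_not_isDegenerate (ht : 0 < t)
    (hu : u ∈ gcPolytope (grassmannPattern 2 n t)) (hd : ¬ IsDegenerate u)
    (hv : v ∈ gcPolytope (grassmannPattern 2 n t)) :
    ∃ s : ℝ, 0 < s ∧ u + s • (u - v) ∈ gcPolytope (grassmannPattern 2 n t) := by
  have hup : ∀ᶠ s in nhdsWithin (0 : ℝ) (Set.Ioi 0), ∀ (j : Fin n) (k : Fin j),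
      0 ≤ (gcEntryₗ n (j + 1) k - gcEntryₗ n j k) (u + s • (u - v)) := by
    refine Filter.eventually_all.mpr fun j => Filter.eventually_all.mpr fun k =>
      eventually_nonneg_add_smul_sub _ ?_
    exact (gcEntry_lt_succ_or_eq ht hu hd k.2 j.2).imp sub_pos.mpr
      fun h => ⟨sub_eq_zero.mpr (h u hu), sub_eq_zero.mpr (h v hv)⟩
  have hdown : ∀ᶠ s in nhdsWithin (0 : ℝ) (Set.Ioi 0), ∀ (j : Fin n) (k : Fin j),
      0 ≤ (gcEntryₗ n j k - gcEntryₗ n (j + 1) (k + 1)) (u + s • (u - v)) := by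
    refine Filter.eventually_all.mpr fun j => Filter.eventually_all.mpr fun k =>
      eventually_nonneg_add_smul_sub _ ?_
    exact (gcEntry_succ_succ_lt_or_eq ht hu hd k.2 j.2).imp sub_pos.mpr
      fun h => ⟨sub_eq_zero.mpr (h u hu), sub_eq_zero.mpr (h v hv)⟩
  obtain ⟨s, ⟨hups, hdowns⟩, hs⟩ :=
    ((hup.and hdown).and (self_mem_nhdsWithin (s := Set.Ioi 0))).exists
  refine ⟨s, hs, mem_gcPolytope_iff.mpr ⟨fun i => ?_,
    fun j k hk hj => sub_nonneg.mp (hups ⟨j, hj⟩ ⟨k, hk⟩),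
    fun j k hk hj => sub_nonneg.mp (hdowns ⟨j, hj⟩ ⟨k, hk⟩)⟩⟩
  rw [← gcEntryₗ_apply, map_add, map_smul, map_sub, gcEntryₗ_apply, gcEntryₗ_apply,
    (mem_gcPolytope_iff.mp hu).1, (mem_gcPolytope_iff.mp hv).1, sub_self, smul_zero, add_zero]

theorem isDegenerate_of_isProperFace (ht : 0 < t) {f : Set (Index n → ℝ)}
    (hf : IsProperFace (grassmannPattern 2 n t) f) (hu : u ∈ f) : IsDegenerate u := by
  by_contra hd
  exact hf.2.2 (eq_of_isExposed_of_forall_exists_add_smul_sub_mem hf.2.1 hu fun v hv =>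
    exists_add_smul_sub_mem_of_not_isDegenerate ht (hf.2.1.subset hu) hd hv)

theorem isDegenerate_of_mem_squareFace {I : Finset ℕ} (hI : IsSquareSequence 2 n I)
    (hu : u ∈ squareFace 2 n t I) : IsDegenerate u := by
  obtain ⟨i, hi⟩ := hI.1
  obtain ⟨h2i, hin⟩ := hI.2.1 i hi
  refine ⟨i - 1, by omega, by omega, Or.inl ?_⟩
  rw [gcEntry, gcEntry, dif_pos (by omega), dif_pos (by omega)]
  exact hu.2 i hi _ _ (by simp only; omega) (by simp only; omega)

end ProperFaces

/-! ### Displacement by permutations -/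

section Displacement

variable {n : ℕ} {t : ℝ} {f : Set (Index n → ℝ)} {x x₀ : orbit (grassmannPattern 2 n t)}
  {A A₀ : Matrix (Fin n) (Fin 2) ℂ}

open Matrix

theorem gcEntry_eq_of_mem_intrinsicInterior {u v : Index n → ℝ} {j k j' k' : ℕ}
    (hf : ∀ v ∈ f, gcEntry v j k ≤ gcEntry v j' k') (hu : u ∈ intrinsicInterior ℝ f)
    (hv : v ∈ f) (h : gcEntry u j' k' = gcEntry u j k) : gcEntry v j' k' = gcEntry v j k :=
  sub_eq_zero.mp (map_eq_zero_of_mem_intrinsicInterior (l := gcEntryₗ n j' k' - gcEntryₗ n j k)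
    (fun v hv => sub_nonneg.mpr (hf v hv)) hu (sub_eq_zero.mpr h) hv)

theorem gcEntry_eq_iff_of_mem_intrinsicInterior {u v : Index n → ℝ} {j k j' k' : ℕ}
    (hf : ∀ v ∈ f, gcEntry v j k ≤ gcEntry v j' k') (hu : u ∈ intrinsicInterior ℝ f)
    (hv : v ∈ intrinsicInterior ℝ f) :
    gcEntry u j' k' = gcEntry u j k ↔ gcEntry v j' k' = gcEntry v j k :=
  ⟨gcEntry_eq_of_mem_intrinsicInterior hf hu (intrinsicInterior_subset hv),
    gcEntry_eq_of_mem_intrinsicInterior hf hv (intrinsicInterior_subset hu)⟩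

section

variable [NeZero n]

theorem sameShape_rowEdge (ht : 0 ≤ t) (hf : f ⊆ gcPolytope (grassmannPattern 2 n t))
    (hxA : (x : Mat n) = A * Aᴴ) (hx : gcMap x ∈ intrinsicInterior ℝ f)
    (hxA₀ : (x₀ : Mat n) = A₀ * A₀ᴴ) (hx₀ : gcMap x₀ ∈ intrinsicInterior ℝ f) :
    SameShape n (periodize (rowEdge A)) (periodize (rowEdge A₀)) := by
  intro j hj
  have hu := hf (intrinsicInterior_subset hx)
  have hu₀ := hf (intrinsicInterior_subset hx₀)
  rw [shrinks_rowEdge_iff ht hu hxA rfl hj, shrinks_rowEdge_iff ht hu₀ hxA₀ rfl hj,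
    grows_rowEdge_iff ht hu hxA rfl hj, grows_rowEdge_iff ht hu₀ hxA₀ rfl hj,
    folds_rowEdge_iff ht hu hxA rfl hj, folds_rowEdge_iff ht hu₀ hxA₀ rfl hj]
  exact ⟨gcEntry_eq_iff_of_mem_intrinsicInterior (fun v hv => gcEntry_le_succ ht (hf hv) hj) hx hx₀,
    gcEntry_eq_iff_of_mem_intrinsicInterior (fun v hv => gcEntry_le_succ ht (hf hv) hj) hx hx₀,
    eq_comm.trans ((gcEntry_eq_iff_of_mem_intrinsicInterior
      (fun v hv => gcEntry_succ_succ_le (hf hv) hj) hx hx₀).trans eq_comm)⟩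

theorem exists_isFlat_rowEdge (ht : 0 ≤ t)
    (hx : gcMap x ∈ gcPolytope (grassmannPattern 2 n t)) (hxA : (x : Mat n) = A * Aᴴ)
    (hd : IsDegenerate (gcMap x)) :
    ∃ j, 1 ≤ j ∧ j + 2 ≤ n ∧ IsFlat (periodize (rowEdge A)) j := by
  obtain ⟨j, hj, hjn, h⟩ := hd
  refine ⟨j, hj, hjn, ?_⟩
  rwa [IsFlat, shrinks_rowEdge_iff ht hx hxA rfl (by omega),
    grows_rowEdge_iff ht hx hxA rfl (by omega), folds_rowEdge_iff ht hx hxA rfl (by omega)]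

theorem permDisplacesFace_of_breaksShape (hn : 2 ≤ n) (ht : 0 < t)
    (hf : f ⊆ gcPolytope (grassmannPattern 2 n t)) (hxA₀ : (x₀ : Mat n) = A₀ * A₀ᴴ)
    (hx₀ : gcMap x₀ ∈ intrinsicInterior ℝ f) {w : Equiv.Perm (Fin n)}
    (hw : BreaksShape w (rowEdge A₀)) : PermDisplacesFace (grassmannPattern 2 n t) f w := by
  refine ⟨isHamiltonianDiffeo_permAct w, Set.disjoint_left.mpr ?_⟩
  rintro _ ⟨x, hx, rfl⟩ hwx
  obtain ⟨A, hA, hxA⟩ := (mem_orbit_grassmannPattern_iff hn ht).mp x.2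
  exact hw (rowEdge A) (sum_rowEdge_eq_zero hA) (sameShape_rowEdge ht.le hf hxA hx hxA₀ hx₀)
    (sameShape_rowEdge ht.le hf (coe_permAct_of_frame w hxA) hwx hxA₀ hx₀)

end

theorem exists_permDisplacesFace (hn : n.Prime) (ht : 0 < t)
    (hf : f ⊆ gcPolytope (grassmannPattern 2 n t))
    (hdeg : ∀ u ∈ intrinsicInterior ℝ f, IsDegenerate u) :
    ∃ w : Equiv.Perm (Fin n), PermDisplacesFace (grassmannPattern 2 n t) f w := by
  have : NeZero n := ⟨hn.ne_zero⟩
  by_cases hne : ∃ x : orbit (grassmannPattern 2 n t), gcMap x ∈ intrinsicInterior ℝ f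
  · obtain ⟨x₀, hx₀⟩ := hne
    obtain ⟨A₀, hA₀, hxA₀⟩ := (mem_orbit_grassmannPattern_iff hn.two_le ht).mp x₀.2
    obtain ⟨w, hw⟩ := exists_breaksShape hn (sum_rowEdge_eq_zero hA₀) (rowEdge_ne_zero ht.ne' hA₀)
      (exists_isFlat_rowEdge ht.le (hf (intrinsicInterior_subset hx₀)) hxA₀ (hdeg _ hx₀))
    exact ⟨w, permDisplacesFace_of_breaksShape hn.two_le ht hf hxA₀ hx₀ hw⟩
  · exact ⟨1, isHamiltonianDiffeo_permAct 1, Set.disjoint_right.mpr fun x hx => absurd ⟨x, hx⟩ hne⟩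

theorem isDisplaceableFace_of_permDisplacesFace {lam : Fin n → ℝ} (hf : f ⊆ gcPolytope lam)
    {w : Equiv.Perm (Fin n)} (hw : PermDisplacesFace lam f w) : IsDisplaceableFace lam f := by
  intro u hu
  refine ⟨_, hw.1, ?_⟩
  rw [(isClosed_gcFiber (hf (intrinsicInterior_subset hu))).closure_eq]
  have hsub : gcFiber lam u ⊆ gcMap ⁻¹' intrinsicInterior ℝ f := by
    rintro x rfl
    exact hu
  exact hw.2.mono (Set.image_mono hsub) hsub

end Displacement

/-! ### Building frames row by row -/

section Tower

open Matrix Polynomial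

variable {n : ℕ} {ι : Type*}

/-- The matrix whose only nonzero row is the `j`-th one, which is `v`. It is zero if `n ≤ j`. -/
def rowAt (n j : ℕ) (v : ι → ℂ) : Matrix (Fin n) ι ℂ :=
  Matrix.of fun i c => if (i : ℕ) = j then v c else 0

theorem firstRows_self (A : Matrix (Fin n) ι ℂ) : firstRows A n = A := by
  ext i c
  rw [firstRows, of_apply, if_pos i.2]

theorem firstRows_zero (A : Matrix (Fin n) ι ℂ) : firstRows A 0 = 0 := rfl

theorem firstRows_succ (A : Matrix (Fin n) ι ℂ) {j : ℕ} (hj : j < n) :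
    firstRows A (j + 1) = firstRows A j + rowAt n j (A ⟨j, hj⟩) := by
  ext i c
  simp only [firstRows, rowAt, of_apply, Matrix.add_apply]
  rcases lt_trichotomy (i : ℕ) j with h | rfl | h
  · rw [if_pos (by omega), if_pos h, if_neg h.ne, add_zero]
  · rw [if_pos (by omega), if_neg (lt_irrefl _), if_pos rfl, zero_add]
  · rw [if_neg (by omega), if_neg (by omega), if_neg h.ne', add_zero]

theorem firstRows_add (A B : Matrix (Fin n) ι ℂ) (j : ℕ) :
    firstRows (A + B) j = firstRows A j + firstRows B j := by
  ext i c
  simp only [firstRows, of_apply, Matrix.add_apply]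
  split_ifs
  · rfl
  · rw [add_zero]

theorem firstRows_rowAt {j k : ℕ} (hjk : j ≤ k) (v : ι → ℂ) : firstRows (rowAt n k v) j = 0 := by
  ext i c
  simp only [firstRows, of_apply, rowAt, Matrix.zero_apply, ite_eq_right_iff]
  omega

section LowerRows

variable {A : Matrix (Fin n) ι ℂ} {j : ℕ}

theorem apply_eq_zero_of_firstRows_eq (hA : firstRows A j = A) {i : Fin n} (hi : j ≤ i) (c : ι) :
    A i c = 0 := by
  rw [← hA, firstRows, of_apply, if_neg (by omega)]

theorem add_rowAt_apply_of_lt (v : ι → ℂ) {i : Fin n} (hi : (i : ℕ) < j) :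
    (A + rowAt n j v) i = A i := by
  funext c
  rw [Matrix.add_apply, rowAt, of_apply, if_neg hi.ne, add_zero]

theorem add_rowAt_apply_self (hA : firstRows A j = A) (v : ι → ℂ) (hj : j < n) :
    (A + rowAt n j v) ⟨j, hj⟩ = v := by
  funext c
  rw [Matrix.add_apply, apply_eq_zero_of_firstRows_eq hA le_rfl, rowAt, of_apply, if_pos rfl,
    zero_add]

theorem firstRows_add_rowAt_succ (hA : firstRows A j = A) (v : ι → ℂ) :
    firstRows (A + rowAt n j v) (j + 1) = A + rowAt n j v := by
  ext i c
  rw [firstRows, of_apply, ite_eq_left_iff]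
  intro hi
  rw [Matrix.add_apply, apply_eq_zero_of_firstRows_eq hA (by omega), rowAt, of_apply,
    if_neg (by omega), add_zero]

theorem gram_add_rowAt (hA : firstRows A j = A) (hj : j < n) (v : ι → ℂ) :
    (A + rowAt n j v)ᴴ * (A + rowAt n j v) = Aᴴ * A + vecMulVec (star v) v := by
  ext a b
  have hentry (i : Fin n) : star ((A + rowAt n j v) i a) * (A + rowAt n j v) i b =
      star (A i a) * A i b + if i = ⟨j, hj⟩ then star (v a) * v b else 0 := by
    split_ifs with h
    · rw [h, add_rowAt_apply_self hA, apply_eq_zero_of_firstRows_eq hA le_rfl, star_zero, zero_mul,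
        zero_add]
    · rw [Matrix.add_apply, Matrix.add_apply, rowAt, of_apply, of_apply,
        if_neg fun hi => h (Fin.ext hi), if_neg fun hi => h (Fin.ext hi), add_zero, add_zero,
        add_zero]
  simp only [mul_apply, conjTranspose_apply, Matrix.add_apply (Aᴴ * A), vecMulVec_apply, hentry,
    Finset.sum_add_distrib, Finset.sum_ite_eq', Finset.mem_univ, if_true, Pi.star_apply]

end LowerRows

section Diagonal

variable [DecidableEq ι]

/-- The Gram matrix of a frame with Gram matrix `diagonal m` after adding the row `v`. -/
def gramAddRow (m : ι → ℝ) (v : ι → ℂ) : Matrix ι ι ℂ :=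
  diagonal (fun c => (m c : ℂ)) + vecMulVec (star v) v

theorem isHermitian_diagonal_ofReal (m : ι → ℝ) :
    (diagonal fun c => (m c : ℂ)).IsHermitian :=
  isHermitian_diagonal_of_self_adjoint _ (funext fun c => Complex.conj_ofReal (m c))

theorem isHermitian_gramAddRow (m : ι → ℝ) (v : ι → ℂ) : (gramAddRow m v).IsHermitian := by
  refine (isHermitian_diagonal_ofReal m).add ?_
  rw [IsHermitian, conjTranspose_vecMulVec, star_star]

/-- The diagonal unitary matrix with the entries of `φ`. -/
noncomputable def phaseMatrix (φ : ι → Circle) : Matrix ι ι ℂ :=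
  diagonal fun c => (φ c : ℂ)

theorem continuous_phaseMatrix : Continuous (phaseMatrix (ι := ι)) :=
  Continuous.matrix_diagonal (by fun_prop)

end Diagonal

theorem mul_circleExp_neg_arg (z : ℂ) : z * Circle.exp (-z.arg) = ‖z‖ := by
  nth_rewrite 1 [← Complex.norm_mul_exp_arg_mul_I z]
  rw [Circle.coe_exp, mul_assoc, ← Complex.exp_add, Complex.ofReal_neg, neg_mul, add_neg_cancel,
    Complex.exp_zero, mul_one]

variable [Fintype ι]

theorem rowAt_mul (j : ℕ) (v : ι → ℂ) (W : Matrix ι ι ℂ) :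
    rowAt n j v * W = rowAt n j (v ᵥ* W) := by
  ext i c
  simp only [mul_apply, rowAt, of_apply, vecMul, dotProduct, ite_mul, zero_mul]
  split_ifs
  · rfl
  · exact Finset.sum_const_zero

theorem firstRows_mul (A : Matrix (Fin n) ι ℂ) (j : ℕ) (W : Matrix ι ι ℂ) :
    firstRows (A * W) j = firstRows A j * W := by
  ext i c
  simp only [mul_apply, firstRows, of_apply, ite_mul, zero_mul]
  split_ifs
  · rfl
  · exact Finset.sum_const_zero.symm

/-- For `i < j` the `(i, j)` entry of `(A + rowAt n j v) * (A + rowAt n j v)ᴴ` is that of the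
column `A *ᵥ star v`. -/
theorem mulVec_star_eq_of_mul_conjTranspose_eq {A B : Matrix (Fin n) ι ℂ} {j : ℕ} (hj : j < n)
    (hA : firstRows A j = A) (hB : firstRows B j = B) {v : ι → ℂ}
    (h : (A + rowAt n j v) * (A + rowAt n j v)ᴴ = (B + rowAt n j v) * (B + rowAt n j v)ᴴ) :
    A *ᵥ star v = B *ᵥ star v := by
  have hentry {M : Matrix (Fin n) ι ℂ} (hM : firstRows M j = M) {i : Fin n} (hi : (i : ℕ) < j) :
      ((M + rowAt n j v) * (M + rowAt n j v)ᴴ) i ⟨j, hj⟩ = (M *ᵥ star v) i := by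
    simp only [mul_apply, conjTranspose_apply, add_rowAt_apply_self hM, add_rowAt_apply_of_lt v hi]
    rfl
  funext i
  rcases lt_or_ge (i : ℕ) j with hi | hi
  · rw [← hentry hA hi, h, hentry hB hi]
  · simp only [mulVec, dotProduct, apply_eq_zero_of_firstRows_eq hA hi,
      apply_eq_zero_of_firstRows_eq hB hi]

variable [DecidableEq ι]

theorem mul_mul_conjTranspose_mul_of_mem_unitaryGroup {κ : Type*} (A : Matrix κ ι ℂ)
    {W : Matrix ι ι ℂ} (hW : W ∈ unitaryGroup ι ℂ) : A * W * (A * W)ᴴ = A * Aᴴ := by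
  have hWW : W * Wᴴ = 1 := mem_unitaryGroup_iff.mp hW
  rw [conjTranspose_mul, Matrix.mul_assoc, ← Matrix.mul_assoc W, hWW, Matrix.one_mul]

theorem charpoly_conjTranspose_mul_mul_of_mem_unitaryGroup (B : Matrix ι ι ℂ) {W : Matrix ι ι ℂ}
    (hW : W ∈ unitaryGroup ι ℂ) : (Wᴴ * B * W).charpoly = B.charpoly := by
  have hWW : W * Wᴴ = 1 := mem_unitaryGroup_iff.mp hW
  rw [Matrix.mul_assoc, charpoly_mul_comm, Matrix.mul_assoc, hWW, Matrix.mul_one]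

theorem exists_mem_unitaryGroup_conjTranspose_mul_mul_eq {𝕜 : Type*} [RCLike 𝕜]
    {B B' : Matrix ι ι 𝕜} (hB : B.IsHermitian) (hB' : B'.IsHermitian)
    (h : B.charpoly = B'.charpoly) :
    ∃ R ∈ unitaryGroup ι 𝕜, Rᴴ * B * R = B' := by
  let R : unitaryGroup ι 𝕜 := hB.eigenvectorUnitary * star hB'.eigenvectorUnitary
  refine ⟨R, R.2, ?_⟩
  calc (R : Matrix ι ι 𝕜)ᴴ * B * R = Unitary.conjStarAlgAut 𝕜 _ (star R) B :=
        (Unitary.conjStarAlgAut_star_apply R B).symm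
    _ = Unitary.conjStarAlgAut 𝕜 _ hB'.eigenvectorUnitary
          (diagonal (RCLike.ofReal ∘ hB.eigenvalues)) := by
      rw [star_mul, star_star, Unitary.conjStarAlgAut_mul_apply,
        hB.conjStarAlgAut_star_eigenvectorUnitary]
    _ = B' := by
      rw [(hB.eigenvalues_eq_eigenvalues_iff hB').mpr h, ← hB'.spectral_theorem]

theorem phaseMatrix_mem_unitaryGroup (φ : ι → Circle) : phaseMatrix φ ∈ unitaryGroup ι ℂ := by
  rw [mem_unitaryGroup_iff', star_eq_conjTranspose, phaseMatrix, diagonal_conjTranspose,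
    diagonal_mul_diagonal, ← diagonal_one]
  congr 1
  funext c
  rw [Pi.star_apply, Complex.star_def, ← Circle.coe_inv_eq_conj, ← Circle.coe_mul, inv_mul_cancel,
    Circle.coe_one]

theorem conjTranspose_phaseMatrix_mul_diagonal_mul (φ : ι → Circle) (a : ι → ℂ) :
    (phaseMatrix φ)ᴴ * diagonal a * phaseMatrix φ = diagonal a := by
  rw [Matrix.mul_assoc, phaseMatrix, diagonal_mul_diagonal, funext fun c => mul_comm (a c) _,
    ← diagonal_mul_diagonal, ← Matrix.mul_assoc]
  have hφ := mem_unitaryGroup_iff'.mp (phaseMatrix_mem_unitaryGroup φ)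
  exact (congrArg (· * diagonal a) hφ).trans (Matrix.one_mul _)

/-- The frame obtained by adding the rows `r j`, twisting the columns by the phases `θ j` before
and applying `R j` after each addition. -/
noncomputable def tower (n : ℕ) (r : ℕ → ι → ℝ) (R : ℕ → Matrix ι ι ℂ) (θ : ℕ → ι → Circle) :
    ℕ → Matrix (Fin n) ι ℂ
  | 0 => 0
  | j + 1 => (tower n r R θ j * phaseMatrix (θ j) + rowAt n j fun c => (r j c : ℂ)) * R j

variable {m r : ℕ → ι → ℝ} {R : ℕ → Matrix ι ι ℂ} {θ θ' : ℕ → ι → Circle}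

theorem firstRows_tower (j : ℕ) : firstRows (tower n r R θ j) j = tower n r R θ j := by
  induction j with
  | zero => exact firstRows_zero _
  | succ j ih =>
    rw [tower, firstRows_mul, firstRows_add_rowAt_succ (by rw [firstRows_mul, ih])]

theorem firstRows_tower_mul (j : ℕ) (W : Matrix ι ι ℂ) :
    firstRows (tower n r R θ j * W) j = tower n r R θ j * W := by
  rw [firstRows_mul, firstRows_tower]

theorem tower_congr {j : ℕ} (h : ∀ i < j, θ i = θ' i) : tower n r R θ j = tower n r R θ' j := by
  induction j with
  | zero => rfl
  | succ j ih => rw [tower, tower, ih fun i hi => h i (by omega), h j (by omega)]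

theorem continuous_tower (j : ℕ) : Continuous fun θ => tower n r R θ j := by
  induction j with
  | zero => exact continuous_const
  | succ j ih =>
    have hphase : Continuous fun θ : ℕ → ι → Circle => phaseMatrix (θ j) :=
      continuous_phaseMatrix.comp (continuous_apply j)
    exact ((ih.matrix_mul hphase).add continuous_const).matrix_mul continuous_const

/-- Adding the row `r` to a frame with Gram matrix `diagonal m` and then applying `R` gives a frame
with Gram matrix `diagonal m'`. Moreover the spectrum `m'` determines the absolute values of the
entries of the new row, up to a rotation if `m = 0`. -/
structure IsRowStep (m m' r : ι → ℝ) (R : Matrix ι ι ℂ) : Prop where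
  unitary : R ∈ unitaryGroup ι ℂ
  diagonalize : Rᴴ * gramAddRow m (fun c => (r c : ℂ)) * R = diagonal fun c => (m' c : ℂ)
  align : ∀ v : ι → ℂ, (gramAddRow m v).charpoly = (diagonal fun c => (m' c : ℂ)).charpoly →
    ∃ W ∈ unitaryGroup ι ℂ, (m = 0 ∨ W = 1) ∧ ∀ c, ‖(v ᵥ* W) c‖ = r c

/-- The data for building frames with `n` rows whose first `j` rows have Gram spectrum `m j`. -/
structure IsTowerData (n : ℕ) (m r : ℕ → ι → ℝ) (R : ℕ → Matrix ι ι ℂ) : Prop where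
  zero : m 0 = 0
  step : ∀ j < n, IsRowStep (m j) (m (j + 1)) (r j) (R j)

namespace IsTowerData

theorem gram_tower (h : IsTowerData n m r R) (θ : ℕ → ι → Circle) {j : ℕ} (hj : j ≤ n) :
    (tower n r R θ j)ᴴ * tower n r R θ j = diagonal fun c => (m j c : ℂ) := by
  induction j with
  | zero => simp [tower, h.zero]
  | succ j ih =>
    have hgram : (tower n r R θ j * phaseMatrix (θ j))ᴴ * (tower n r R θ j * phaseMatrix (θ j)) =
        diagonal fun c => (m j c : ℂ) := by
      rw [conjTranspose_mul, Matrix.mul_assoc, ← Matrix.mul_assoc _ᴴ _ (phaseMatrix _),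
        ih (by omega), ← Matrix.mul_assoc, conjTranspose_phaseMatrix_mul_diagonal_mul]
    rw [tower, conjTranspose_mul, Matrix.mul_assoc, ← Matrix.mul_assoc _ _ (R j),
      gram_add_rowAt (firstRows_tower_mul j _) hj, hgram, ← Matrix.mul_assoc]
    exact (h.step j hj).diagonalize

theorem exists_firstRows_tower (h : IsTowerData n m r R) (θ : ℕ → ι → Circle) {j k : ℕ}
    (hjk : j ≤ k) (hk : k ≤ n) :
    ∃ W ∈ unitaryGroup ι ℂ, firstRows (tower n r R θ k) j = tower n r R θ j * W := by
  induction k, hjk using Nat.le_induction with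
  | base => exact ⟨1, one_mem _, by rw [firstRows_tower, Matrix.mul_one]⟩
  | succ k hjk ih =>
    obtain ⟨W, hW, hWk⟩ := ih (by omega)
    refine ⟨W * phaseMatrix (θ k) * R k,
      mul_mem (mul_mem hW (phaseMatrix_mem_unitaryGroup (θ k))) (h.step k hk).unitary, ?_⟩
    rw [tower, firstRows_mul, firstRows_add, firstRows_mul, hWk, firstRows_rowAt hjk, add_zero]
    simp only [Matrix.mul_assoc]

theorem charpoly_frameGram_tower (h : IsTowerData n m r R) (θ : ℕ → ι → Circle) {j : ℕ}
    (hj : j ≤ n) :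
    (frameGram (tower n r R θ n) j).charpoly = (diagonal fun c => (m j c : ℂ)).charpoly := by
  obtain ⟨W, hW, hWj⟩ := h.exists_firstRows_tower θ hj le_rfl
  rw [frameGram, hWj, conjTranspose_mul, Matrix.mul_assoc, ← Matrix.mul_assoc _ _ W,
    h.gram_tower θ hj, ← Matrix.mul_assoc, charpoly_conjTranspose_mul_mul_of_mem_unitaryGroup _ hW]

/-- The phase `θ j c` can be read off from the frame. -/
def IsFree (n : ℕ) (m r : ℕ → ι → ℝ) (j : ℕ) (c : ι) : Prop :=
  j < n ∧ m j c ≠ 0 ∧ r j c ≠ 0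

theorem tower_mul_conjTranspose_congr (h : IsTowerData n m r R)
    (heq : tower n r R θ n * (tower n r R θ n)ᴴ = tower n r R θ' n * (tower n r R θ' n)ᴴ) {j : ℕ}
    (hj : j ≤ n) :
    tower n r R θ j * (tower n r R θ j)ᴴ = tower n r R θ' j * (tower n r R θ' j)ᴴ := by
  have hsub (θ : ℕ → ι → Circle) : tower n r R θ j * (tower n r R θ j)ᴴ =
      Matrix.of fun i k : Fin n => if (i : ℕ) < j ∧ (k : ℕ) < j then
        (tower n r R θ n * (tower n r R θ n)ᴴ) i k else 0 := by
    obtain ⟨W, hW, hWj⟩ := h.exists_firstRows_tower θ hj le_rfl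
    rw [← mul_mul_conjTranspose_mul_of_mem_unitaryGroup _ hW, ← hWj]
    ext i k
    simp only [mul_apply, conjTranspose_apply, firstRows, of_apply]
    by_cases h1 : (i : ℕ) < j <;> by_cases h2 : (k : ℕ) < j <;> simp [h1, h2]
  rw [hsub, hsub, heq]

theorem phase_eq_of_isFree (h : IsTowerData n m r R) {j : ℕ} {c : ι} (hf : IsFree n m r j c)
    (hθ : ∀ i < j, θ i = θ' i)
    (heq : tower n r R θ (j + 1) * (tower n r R θ (j + 1))ᴴ =
      tower n r R θ' (j + 1) * (tower n r R θ' (j + 1))ᴴ) : θ j c = θ' j c := by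
  obtain ⟨hj, hm, hr⟩ := hf
  have hR := (h.step j hj).unitary
  rw [tower, tower, ← tower_congr hθ, mul_mul_conjTranspose_mul_of_mem_unitaryGroup _ hR,
    mul_mul_conjTranspose_mul_of_mem_unitaryGroup _ hR] at heq
  have hcol := congrArg ((tower n r R θ j)ᴴ *ᵥ ·) (mulVec_star_eq_of_mul_conjTranspose_eq hj
    (firstRows_tower_mul j _) (firstRows_tower_mul j _) heq)
  simp only [mulVec_mulVec, ← Matrix.mul_assoc, h.gram_tower θ hj.le] at hcol
  have hc := congrFun hcol c
  simp only [phaseMatrix, diagonal_mul_diagonal, mulVec_diagonal, Pi.star_apply, Complex.star_def,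
    Complex.conj_ofReal] at hc
  exact Circle.ext (mul_left_cancel₀ (Complex.ofReal_ne_zero.mpr hm)
    (mul_right_cancel₀ (Complex.ofReal_ne_zero.mpr hr) hc))

theorem phase_injective (h : IsTowerData n m r R)
    (hfree : ∀ j c, ¬ IsFree n m r j c → θ j c = θ' j c)
    (heq : tower n r R θ n * (tower n r R θ n)ᴴ = tower n r R θ' n * (tower n r R θ' n)ᴴ) :
    θ = θ' := by
  funext j
  induction j using Nat.strong_induction_on with
  | _ j ih =>
    funext c
    by_cases hf : IsFree n m r j c
    · exact h.phase_eq_of_isFree hf ih (h.tower_mul_conjTranspose_congr heq hf.1)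
    · exact hfree j c hf

open scoped ComplexOrder in
theorem tower_apply_eq_zero (h : IsTowerData n m r R) {j : ℕ} (hj : j ≤ n) {c : ι}
    (hm : m j c = 0) (i : Fin n) : tower n r R θ j i c = 0 := by
  have hdiag := congrFun₂ (h.gram_tower θ hj) c c
  rw [mul_apply, diagonal_apply_eq, hm, Complex.ofReal_zero] at hdiag
  have hcol : (fun i => tower n r R θ j i c) = 0 := dotProduct_star_self_eq_zero.mp hdiag
  exact congrFun hcol i

theorem gramAddRow_vecMul (h : IsTowerData n m r R) {A : Matrix (Fin n) ι ℂ} {j : ℕ} (hj : j < n)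
    {V : Matrix ι ι ℂ} (hV : firstRows A j * V = tower n r R θ j) :
    gramAddRow (m j) (A ⟨j, hj⟩ ᵥ* V) = Vᴴ * frameGram A (j + 1) * V := by
  rw [gramAddRow, ← h.gram_tower θ hj.le, ← gram_add_rowAt (firstRows_tower j) hj, ← hV,
    ← rowAt_mul, ← Matrix.add_mul, ← firstRows_succ, conjTranspose_mul, frameGram]
  simp only [Matrix.mul_assoc]

theorem exists_phases_step (h : IsTowerData n m r R) {A : Matrix (Fin n) ι ℂ} {j : ℕ} (hj : j < n)
    (hA : (frameGram A (j + 1)).charpoly = (diagonal fun c => (m (j + 1) c : ℂ)).charpoly)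
    {V : Matrix ι ι ℂ} (hV : V ∈ unitaryGroup ι ℂ) (hAV : firstRows A j * V = tower n r R θ j) :
    ∃ φ : ι → Circle, (∀ c, ¬ IsFree n m r j c → φ c = 1) ∧
      ∃ V' ∈ unitaryGroup ι ℂ, firstRows A (j + 1) * V' =
        (tower n r R θ j * phaseMatrix φ + rowAt n j fun c => (r j c : ℂ)) * R j := by
  classical
  obtain ⟨W, hW, hW1, hWr⟩ := (h.step j hj).align (A ⟨j, hj⟩ ᵥ* V) (by
    rw [h.gramAddRow_vecMul hj hAV, charpoly_conjTranspose_mul_mul_of_mem_unitaryGroup _ hV, hA])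
  have hTW : tower n r R θ j * W = tower n r R θ j := by
    rcases hW1 with hm | rfl
    · have hT : tower n r R θ j = 0 :=
        Matrix.ext fun i c => h.tower_apply_eq_zero hj.le (congrFun hm c) i
      rw [hT, Matrix.zero_mul]
    · exact Matrix.mul_one _
  let ψ : ι → Circle := fun c => Circle.exp (-(((A ⟨j, hj⟩ ᵥ* V) ᵥ* W) c).arg)
  have hrow : ((A ⟨j, hj⟩ ᵥ* V) ᵥ* W) ᵥ* phaseMatrix ψ = fun c => (r j c : ℂ) := by
    funext c
    rw [phaseMatrix, vecMul_diagonal, mul_circleExp_neg_arg, hWr]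
  let φ : ι → Circle := fun c => if IsFree n m r j c then ψ c else 1
  have hψφ : tower n r R θ j * phaseMatrix ψ = tower n r R θ j * phaseMatrix φ := by
    ext i c
    rw [phaseMatrix, phaseMatrix, mul_diagonal, mul_diagonal]
    by_cases hm : m j c = 0
    · rw [h.tower_apply_eq_zero hj.le hm, zero_mul, zero_mul]
    by_cases hr : r j c = 0
    · have hψ : ψ c = 1 := by
        simp only [ψ, norm_eq_zero.mp ((hWr c).trans hr), Complex.arg_zero, neg_zero,
          Circle.exp_zero]
      simp only [φ, hψ, ite_self]
    · simp only [φ, if_pos (show IsFree n m r j c from ⟨hj, hm, hr⟩)]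
  refine ⟨φ, fun c hc => if_neg hc, V * W * phaseMatrix ψ * R j,
    mul_mem (mul_mem (mul_mem hV hW) (phaseMatrix_mem_unitaryGroup ψ))
      (h.step j hj).unitary, ?_⟩
  simp only [← Matrix.mul_assoc, firstRows_succ A hj, Matrix.add_mul, rowAt_mul, hAV, hTW, hψφ,
    hrow]

theorem exists_phases (h : IsTowerData n m r R) {A : Matrix (Fin n) ι ℂ}
    (hA : ∀ j ≤ n, (frameGram A j).charpoly = (diagonal fun c => (m j c : ℂ)).charpoly) {j : ℕ}
    (hj : j ≤ n) :
    ∃ θ : ℕ → ι → Circle, (∀ j c, ¬ IsFree n m r j c → θ j c = 1) ∧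
      ∃ V ∈ unitaryGroup ι ℂ, firstRows A j * V = tower n r R θ j := by
  induction j with
  | zero => exact ⟨1, fun _ _ _ => rfl, 1, one_mem _, Matrix.mul_one _⟩
  | succ j ih =>
    obtain ⟨θ, hθ, V, hV, hAV⟩ := ih (by omega)
    obtain ⟨φ, hφ, V', hV', hAV'⟩ := h.exists_phases_step hj (hA (j + 1) hj) hV hAV
    refine ⟨Function.update θ j φ, fun k c hc => ?_, V', hV', ?_⟩
    · rcases eq_or_ne k j with rfl | hk
      · rw [Function.update_self, hφ c hc]
      · rw [Function.update_of_ne hk, hθ k c hc]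
    · rw [tower, Function.update_self, hAV',
        tower_congr fun i hi => Function.update_of_ne hi.ne φ θ]

end IsTowerData

end Tower

/-! ### Generic fibers are tori -/

section Torus

open Matrix Polynomial

section FirstRow

variable {ι : Type*} [DecidableEq ι]

theorem gramAddRow_zero (v : ι → ℂ) : gramAddRow 0 v = vecMulVec (star v) v := by
  rw [gramAddRow]
  simp only [Pi.zero_apply, Complex.ofReal_zero, diagonal_zero, zero_add]

variable [Fintype ι]

theorem exists_norm_vecMul_eq_sqrt {m : ι → ℝ} {v : ι → ℂ}
    (h : (vecMulVec (star v) v).charpoly = (diagonal fun c => (m c : ℂ)).charpoly) :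
    ∃ W ∈ unitaryGroup ι ℂ, ∀ c, ‖(v ᵥ* W) c‖ = √(m c) := by
  have hherm : (vecMulVec (star v) v).IsHermitian := by
    rw [IsHermitian, conjTranspose_vecMulVec, star_star]
  obtain ⟨W, hW, hdiag⟩ :=
    exists_mem_unitaryGroup_conjTranspose_mul_mul_eq hherm (isHermitian_diagonal_ofReal m) h
  refine ⟨W, hW, fun c => ?_⟩
  rw [mul_vecMulVec, vecMulVec_mul, ← star_vecMul] at hdiag
  have hc := congrFun₂ hdiag c c
  rw [vecMulVec_apply, Pi.star_apply, diagonal_apply_eq, Complex.star_def,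
    Complex.conj_mul'] at hc
  have hc' : ‖(v ᵥ* W) c‖ ^ 2 = m c := by exact_mod_cast hc
  rw [← hc', Real.sqrt_sq (norm_nonneg _)]

theorem isRowStep_zero {m : ι → ℝ} (hm : 0 ≤ m) (hrank : ∀ a b, a ≠ b → m a * m b = 0) :
    IsRowStep 0 m (fun c => √(m c)) 1 where
  unitary := one_mem _
  diagonalize := by
    rw [conjTranspose_one, Matrix.one_mul, Matrix.mul_one, gramAddRow_zero]
    ext a b
    rw [vecMulVec_apply, Pi.star_apply, Complex.star_def, Complex.conj_ofReal, ← Complex.ofReal_mul,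
      ← Real.sqrt_mul (hm a)]
    rcases eq_or_ne a b with rfl | hab
    · rw [diagonal_apply_eq, Real.sqrt_mul_self (hm a)]
    · rw [diagonal_apply_ne _ hab, hrank a b hab, Real.sqrt_zero, Complex.ofReal_zero]
  align v hv := by
    rw [gramAddRow_zero] at hv
    obtain ⟨W, hW, hWv⟩ := exists_norm_vecMul_eq_sqrt hv
    exact ⟨W, hW, Or.inl rfl, hWv⟩

end FirstRow

section LaterRows

variable {m m' : Fin 2 → ℝ}

theorem trace_gramAddRow (m : Fin 2 → ℝ) (v : Fin 2 → ℂ) :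
    (gramAddRow m v).trace = ((m 0 + m 1 + (‖v 0‖ ^ 2 + ‖v 1‖ ^ 2) : ℝ) : ℂ) := by
  simp only [gramAddRow, trace_add, trace_fin_two, diagonal_apply_eq, vecMulVec_apply,
    Pi.star_apply, Complex.star_def, Complex.conj_mul']
  push_cast
  rfl

theorem det_gramAddRow (m : Fin 2 → ℝ) (v : Fin 2 → ℂ) :
    (gramAddRow m v).det =
      ((m 0 * m 1 + (m 0 * ‖v 1‖ ^ 2 + m 1 * ‖v 0‖ ^ 2) : ℝ) : ℂ) := by
  rw [gramAddRow, det_fin_two]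
  simp only [Matrix.add_apply, diagonal_apply_eq, diagonal_apply_ne _ zero_ne_one,
    diagonal_apply_ne _ one_ne_zero, vecMulVec_apply, Pi.star_apply, Complex.star_def]
  push_cast
  rw [← Complex.conj_mul', ← Complex.conj_mul']
  ring

theorem charpoly_gramAddRow_eq_iff (v : Fin 2 → ℂ) :
    (gramAddRow m v).charpoly = (diagonal fun c => (m' c : ℂ)).charpoly ↔
      m 0 + m 1 + (‖v 0‖ ^ 2 + ‖v 1‖ ^ 2) = m' 0 + m' 1 ∧
        m 0 * m 1 + (m 0 * ‖v 1‖ ^ 2 + m 1 * ‖v 0‖ ^ 2) = m' 0 * m' 1 := by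
  rw [charpoly_diagonal, Fin.prod_univ_two, charpoly_fin_two_eq_iff, trace_gramAddRow,
    det_gramAddRow, ← Complex.ofReal_add, ← Complex.ofReal_mul, Complex.ofReal_inj,
    Complex.ofReal_inj]

theorem trace_det_eq_iff {a b a' b' : ℝ} (hab : a ≠ b) (x y : ℝ) :
    a + b + (x + y) = a' + b' ∧ a * b + (a * y + b * x) = a' * b' ↔
      x = (a' - a) * (a - b') / (a - b) ∧ y = (a' - b) * (b' - b) / (a - b) := by
  have hd : a - b ≠ 0 := sub_ne_zero.mpr hab
  rw [eq_div_iff hd, eq_div_iff hd]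
  constructor
  · rintro ⟨htrace, hdet⟩
    exact ⟨by linear_combination a * htrace - hdet, by linear_combination hdet - b * htrace⟩
  · rintro ⟨hx, hy⟩
    constructor <;> apply mul_left_cancel₀ hd
    · linear_combination hx + hy
    · linear_combination b * hx + a * hy

theorem exists_charpoly_gramAddRow_eq_iff (hm : m 1 < m 0) (h0 : m 0 ≤ m' 0) (h1 : m 1 ≤ m' 1)
    (h10 : m' 1 ≤ m 0) :
    ∃ r : Fin 2 → ℝ, 0 ≤ r ∧ ∀ v : Fin 2 → ℂ,
      (gramAddRow m v).charpoly = (diagonal fun c => (m' c : ℂ)).charpoly ↔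
        ∀ c, ‖v c‖ = r c := by
  let s : Fin 2 → ℝ := ![(m' 0 - m 0) * (m 0 - m' 1) / (m 0 - m 1),
    (m' 0 - m 1) * (m' 1 - m 1) / (m 0 - m 1)]
  have hs : ∀ c, 0 ≤ s c := Fin.forall_fin_two.mpr
    ⟨div_nonneg (mul_nonneg (by linarith) (by linarith)) (by linarith),
      div_nonneg (mul_nonneg (by linarith) (by linarith)) (by linarith)⟩
  refine ⟨fun c => √(s c), fun c => Real.sqrt_nonneg _, fun v => ?_⟩
  have hsqrt (c : Fin 2) : ‖v c‖ = √(s c) ↔ ‖v c‖ ^ 2 = s c := by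
    rw [eq_comm, Real.sqrt_eq_iff_eq_sq (hs c) (norm_nonneg _), eq_comm]
  rw [charpoly_gramAddRow_eq_iff, trace_det_eq_iff hm.ne', Fin.forall_fin_two, hsqrt, hsqrt]
  rfl

theorem exists_isRowStep (hm : m 1 < m 0) (h0 : m 0 ≤ m' 0) (h1 : m 1 ≤ m' 1)
    (h10 : m' 1 ≤ m 0) : ∃ r R, IsRowStep m m' r R := by
  obtain ⟨r, hr, hiff⟩ := exists_charpoly_gramAddRow_eq_iff hm h0 h1 h10
  have hcharpoly := (hiff fun c => (r c : ℂ)).mpr fun c => Complex.norm_of_nonneg (hr c)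
  obtain ⟨R, hR, hdiag⟩ := exists_mem_unitaryGroup_conjTranspose_mul_mul_eq
    (isHermitian_gramAddRow m _) (isHermitian_diagonal_ofReal m') hcharpoly
  refine ⟨r, R, hR, hdiag, fun v hv => ⟨1, one_mem _, Or.inr rfl, ?_⟩⟩
  rw [vecMul_one]
  exact (hiff v).mp hv

end LaterRows

variable {n d : ℕ} {t : ℝ} {u : Index n → ℝ}

theorem exists_isTowerData (ht : 0 ≤ t) (hu : u ∈ gcPolytope (grassmannPattern 2 n t))
    (hlt : ∀ j, 1 ≤ j → j < n → gcEntry u j 1 < gcEntry u j 0) :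
    ∃ r R, IsTowerData n (fun j (c : Fin 2) => gcEntry u j c) r R := by
  have hzero : (fun c : Fin 2 => gcEntry u 0 c) = 0 :=
    funext fun c => gcEntry_of_le u (Nat.zero_le _)
  have hstep (j : ℕ) (hj : j < n) : ∃ r R,
      IsRowStep (fun c : Fin 2 => gcEntry u j c) (fun c => gcEntry u (j + 1) c) r R := by
    rcases Nat.eq_zero_or_pos j with rfl | hj0
    · rw [hzero]
      refine ⟨_, _, isRowStep_zero (fun c => gcEntry_nonneg ht hu _ _) fun a b hab => ?_⟩
      obtain ha | hb : 1 ≤ (a : ℕ) ∨ 1 ≤ (b : ℕ) := by omega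
      · rw [gcEntry_of_le u ha, zero_mul]
      · rw [gcEntry_of_le u hb, mul_zero]
    · exact exists_isRowStep (hlt j hj0 hj) (gcEntry_le_succ ht hu hj) (gcEntry_le_succ ht hu hj)
        (gcEntry_succ_succ_le hu hj)
  choose! r R hrR using hstep
  exact ⟨r, R, hzero, hrR⟩

theorem isTorus_of_continuous_bijective {α ι : Type*} [TopologicalSpace α] [T2Space α]
    [Finite ι] {Y : Set α} {f : (ι → Circle) → Y} (hf : Continuous f)
    (hbij : Function.Bijective f) : IsTorus Y := by
  have := Fintype.ofFinite ι
  let e : (ι → Circle) ≃ₜ Y := Continuous.homeoOfEquivCompactToT2 (f := Equiv.ofBijective f hbij) hf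
  exact ⟨Fintype.card ι, ⟨e.symm.trans
    (Homeomorph.piCongrLeft (Y := fun _ => Circle) (Fintype.equivFin ι))⟩⟩

section FreePhases

variable {ι : Type*} {m r : ℕ → ι → ℝ}

/-- The positions of the free phases, by which the points of a generic fiber are parametrized. -/
abbrev FreeIndex (n : ℕ) (m r : ℕ → ι → ℝ) : Type _ :=
  {q : Fin n × ι // IsTowerData.IsFree n m r q.1 q.2}

open Classical in
/-- The phases that are not free are put equal to `1`. -/
noncomputable def extendPhases (φ : FreeIndex n m r → Circle) (j : ℕ) (c : ι) : Circle :=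
  if h : IsTowerData.IsFree n m r j c then φ ⟨(⟨j, h.1⟩, c), h⟩ else 1

theorem extendPhases_of_isFree (φ : FreeIndex n m r → Circle) (q : FreeIndex n m r) :
    extendPhases φ q.1.1 q.1.2 = φ q :=
  dif_pos q.2

theorem extendPhases_of_not_isFree (φ : FreeIndex n m r → Circle) {j : ℕ} {c : ι}
    (h : ¬ IsTowerData.IsFree n m r j c) : extendPhases φ j c = 1 :=
  dif_neg h

theorem extendPhases_restrict {θ : ℕ → ι → Circle}
    (hθ : ∀ j c, ¬ IsTowerData.IsFree n m r j c → θ j c = 1) :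
    extendPhases (fun q : FreeIndex n m r => θ q.1.1 q.1.2) = θ := by
  funext j c
  by_cases h : IsTowerData.IsFree n m r j c
  · exact dif_pos h
  · rw [extendPhases_of_not_isFree _ h, hθ j c h]

theorem continuous_extendPhases :
    Continuous (extendPhases : (FreeIndex n m r → Circle) → ℕ → ι → Circle) := by
  refine continuous_pi fun j => continuous_pi fun c => ?_
  by_cases h : IsTowerData.IsFree n m r j c
  · simp only [extendPhases, dif_pos h]
    exact continuous_apply _
  · simp only [extendPhases, dif_neg h]
    exact continuous_const

end FreePhases

section Fiber

variable {r : ℕ → Fin d → ℝ} {R : ℕ → Matrix (Fin d) (Fin d) ℂ}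

theorem gcMap_eq_iff_charpoly_diagonal (ht : 0 ≤ t)
    (hu : u ∈ gcPolytope (grassmannPattern d n t)) (x : orbit (grassmannPattern d n t))
    {A : Matrix (Fin n) (Fin d) ℂ} (hx : (x : Mat n) = A * Aᴴ) :
    gcMap x = u ↔ ∀ j ≤ n,
      (frameGram A j).charpoly = (diagonal fun c : Fin d => (gcEntry u j c : ℂ)).charpoly := by
  simp only [gcMap_eq_iff_charpoly_frameGram ht hu x hx, charpoly_diagonal]

theorem tower_mul_conjTranspose_mem_orbit (hd : d ≤ n) (ht : 0 < t)
    (hu : u ∈ gcPolytope (grassmannPattern d n t))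
    (h : IsTowerData n (fun j (c : Fin d) => gcEntry u j c) r R) (θ : ℕ → Fin d → Circle) :
    tower n r R θ n * (tower n r R θ n)ᴴ ∈ orbit (grassmannPattern d n t) := by
  refine (mem_orbit_grassmannPattern_iff hd ht).mpr ⟨_, ?_, rfl⟩
  rw [h.gram_tower θ le_rfl, ← diagonal_one, ← diagonal_smul]
  congr 1
  funext c
  rw [gcEntry_eq_of_lt ht.le hu le_rfl (by omega) (by omega), Pi.smul_apply, smul_eq_mul, mul_one]

theorem isTorus_gcFiber_of_isTowerData (hd : d ≤ n) (ht : 0 < t)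
    (hu : u ∈ gcPolytope (grassmannPattern d n t))
    (h : IsTowerData n (fun j (c : Fin d) => gcEntry u j c) r R) :
    IsTorus (gcFiber (grassmannPattern d n t) u) := by
  let toOrbit (θ : ℕ → Fin d → Circle) : orbit (grassmannPattern d n t) :=
    ⟨_, tower_mul_conjTranspose_mem_orbit hd ht hu h θ⟩
  have hfiber (θ : ℕ → Fin d → Circle) : toOrbit θ ∈ gcFiber (grassmannPattern d n t) u :=
    (gcMap_eq_iff_charpoly_diagonal ht.le hu _ rfl).mpr fun _ hj =>
      h.charpoly_frameGram_tower θ hj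
  have hcontinuous : Continuous toOrbit :=
    ((continuous_tower n).matrix_mul (continuous_tower n).matrix_conjTranspose).subtype_mk _
  refine isTorus_of_continuous_bijective (ι := FreeIndex n (fun j (c : Fin d) => gcEntry u j c) r)
    (f := fun φ => ⟨toOrbit (extendPhases φ), hfiber _⟩)
    ((hcontinuous.comp continuous_extendPhases).subtype_mk _) ⟨fun φ φ' heq => ?_, ?_⟩
  · have hphases : extendPhases φ = extendPhases φ' := h.phase_injective
      (fun j c hf => by rw [extendPhases_of_not_isFree φ hf, extendPhases_of_not_isFree φ' hf])
      (congrArg (fun x => ((x : orbit (grassmannPattern d n t)) : Mat n)) (Subtype.ext_iff.mp heq))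
    funext q
    rw [← extendPhases_of_isFree φ, hphases, extendPhases_of_isFree]
  · rintro ⟨x, hx⟩
    obtain ⟨A, -, hA⟩ := (mem_orbit_grassmannPattern_iff hd ht).mp x.2
    obtain ⟨θ, hθ, V, hV, hAV⟩ :=
      h.exists_phases ((gcMap_eq_iff_charpoly_diagonal ht.le hu x hA).mp hx) le_rfl
    refine ⟨fun q => θ q.1.1 q.1.2, Subtype.ext (Subtype.ext ?_)⟩
    change tower n r R (extendPhases _) n * (tower n r R (extendPhases _) n)ᴴ = x
    rw [extendPhases_restrict hθ, ← hAV, firstRows_self,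
      mul_mul_conjTranspose_mul_of_mem_unitaryGroup _ hV, hA]

end Fiber

theorem isTorus_gcFiber_of_not_isDegenerate (hn : 2 ≤ n) (ht : 0 < t)
    (hu : u ∈ gcPolytope (grassmannPattern 2 n t)) (hd : ¬ IsDegenerate u) :
    IsTorus (gcFiber (grassmannPattern 2 n t) u) := by
  obtain ⟨r, R, h⟩ := exists_isTowerData ht.le hu fun j h1 hj =>
    gcEntry_one_lt_gcEntry_zero_of_not_isDegenerate ht hu hd h1 hj
  exact isTorus_gcFiber_of_isTowerData hn ht hu h

end Torus

end GelfandCetlin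

theorem theoremE_general (p : ℕ) (hp : p.Prime) (t : ℝ) (ht : 0 < t) :
    (∀ u ∈ gcPolytope (grassmannPattern 2 p t),
      ¬ IsTorus (gcFiber (grassmannPattern 2 p t) u) →
      IsDisplaceable (gcFiber (grassmannPattern 2 p t) u)) ∧
    (∀ f : Set (Index p → ℝ),
      IsProperFace (grassmannPattern 2 p t) f →
      IsDisplaceableFace (grassmannPattern 2 p t) f ∧
      ∃ w : Equiv.Perm (Fin p), PermDisplacesFace (grassmannPattern 2 p t) f w) ∧
    (∀ I : Finset ℕ, IsSquareSequence 2 p I →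
      ∃ w : Equiv.Perm (Fin p),
        PermDisplacesFace (grassmannPattern 2 p t) (squareFace 2 p t I) w) := by
  refine ⟨fun u hu htorus => ?_, fun f hf => ?_, fun I hI => ?_⟩
  · have hdeg : IsDegenerate u := by
      by_contra hd
      exact htorus (isTorus_gcFiber_of_not_isDegenerate hp.two_le ht hu hd)
    have hsub : {u} ⊆ gcPolytope (grassmannPattern 2 p t) := Set.singleton_subset_iff.mpr hu
    obtain ⟨w, hw⟩ := exists_permDisplacesFace hp ht hsub fun v hv =>
      (Set.mem_singleton_iff.mp (intrinsicInterior_subset hv)).symm ▸ hdeg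
    exact isDisplaceableFace_of_permDisplacesFace hsub hw u (by simp)
  · have hsub : f ⊆ gcPolytope (grassmannPattern 2 p t) := hf.2.1.subset
    obtain ⟨w, hw⟩ := exists_permDisplacesFace hp ht hsub fun u hu =>
      isDegenerate_of_isProperFace ht hf (intrinsicInterior_subset hu)
    exact ⟨isDisplaceableFace_of_permDisplacesFace hsub hw, w, hw⟩
  · exact exists_permDisplacesFace hp ht (fun u hu => hu.1) fun u hu =>
      isDegenerate_of_mem_squareFace hI (intrinsicInterior_subset hu)

theorem theoremE (p : ℕ) (hp : p.Prime) (t : ℝ) (ht : 0 < t) :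
    (∀ u ∈ gcPolytope (grassmannPattern 2 p t),
      IsLagrangian (gcFiber (grassmannPattern 2 p t) u) →
      ¬ IsTorus (gcFiber (grassmannPattern 2 p t) u) →
      IsDisplaceable (gcFiber (grassmannPattern 2 p t) u)) ∧
    (∀ f : Set (Index p → ℝ),
      IsProperFace (grassmannPattern 2 p t) f →
      IsLagrangianFace (grassmannPattern 2 p t) f →
      IsDisplaceableFace (grassmannPattern 2 p t) f ∧
      ∃ w : Equiv.Perm (Fin p), PermDisplacesFace (grassmannPattern 2 p t) f w) ∧
    (∀ I : Finset ℕ, IsSquareSequence 2 p I →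
      ∃ w : Equiv.Perm (Fin p),
        PermDisplacesFace (grassmannPattern 2 p t) (squareFace 2 p t I) w) := by
  obtain ⟨hfibers, hfaces, hsquares⟩ := theoremE_general p hp t ht
  exact ⟨fun u hu _ => hfibers u hu, fun f hf _ => hfaces f hf, hsquares⟩
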